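/- Let $N\in\mathbb N$, $S_0>0$, $\Delta t>0$, $r\in\mathbb R$ and $0<\sigma<\frac{1}{2\Delta t}$. Put $\rho(y)=e^{\sigma y-r\Delta t}-1$, $\rho^+=\max(\rho,0)$, $\rho^-=\max(-\rho,0)$, $d=-\frac{r\Delta t}{\sigma}$, $\Omega^-=\{\rho\le 0\}=(-\infty,-d]$, $\Omega^+=\{\rho>0\}=(-d,\infty)$. Let $P$ be the normal law on $\mathbb R$ with mean $0$ and variance $\Delta t$, let $P^\pm$ be its restrictions to $\Omega^\pm$, and let $\mu=P^-\times P^+$ on $\Omega^-\times\Omega^+$. Let $M_1$ be the set of measures $Q$ on $\mathbb R$ of the form $$Q(A)=\int \chi_A(y_1)\,\alpha(y_1,y_2)\frac{\rho^+(y_2)}{\rho^-(y_1)+\rho^+(y_2)}\,d\mu(y_1,y_2)+\int \chi_A(y_2)\,\alpha(y_1,y_2)\frac{\rho^-(y_1)}{\rho^-(y_1)+\rho^+(y_2)}\,d\mu(y_1,y_2),$$ where $\alpha\ge 0$ is measurable, $\mu(\{\alpha>0\})=P(\Omega^+)P(\Omega^-)$, $\int\alpha\,\frac{\rho^-(y_1)\rho^+(y_2)}{\rho^-(y_1)+\rho^+(y_2)}\,d\mu<\infty$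 and $\int\alpha\,d\mu=1$. Let $M^N$ be the set of products $Q_1\times\dots\times Q_N$ with all $Q_i\in M_1$, and let $M_0^N$ be the convex span of $M^N$. For $y=(y_1,\dots,y_N)\in\mathbb R^N$ let $\zeta_n=y_1+\dots+y_n$, and let the discounted price of the risk asset be the discrete geometric Brownian motion $S_n=S_0e^{\sigma\zeta_n-nr\Delta t}$. Let $f$ be a Borel measurable payment function such that $f(S_N)$ is integrable with respect to every $Q\in M_0^N$ and $\sup_{Q\in M_0^N}E^Qf(S_N)<\infty$. Suppose that $f$ has no upward spikes on null sets, that is, for all $x>0$ and $\varepsilon,\delta>0$ the set $\{z: |z-x|<\delta,\ f(z)>f(x)-\varepsilon\}$ has positive Lebesgue measure (this holds, for instance, if $f$ is continuous, lower semicontinuous, one-sidedly continuous or monotone on $(0,\infty)$). Then the super-hedge fair price $\sup_{Q\in M_0^N}E^Qf(S_N)$ is given by $$\sup_{Q\in M_0^N}E^Qf(S_N)=\sup_{y_s^1\le -d<y_s^2,\ s=1,\dots,N}\ \sum_{i_1,\dots,i_N=1}^{2} f\Big(S_0\prod_{s=1}^N\big(1+\rho(y_s^{i_s})\big)\Big)\prod_{s=1}^N\frac{\big|e^{\sigma(d+y_s^{i_s+1})}-1\big|}{\big|e^{\sigma(d+y_s^{i_s+1})}-e^{\sigma(d+y_s^{i_s})}\big|},$$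 where $y_s^3=y_s^1$; in particular the right-hand side is finite. -/

import Mathlib

open MeasureTheory ProbabilityTheory

noncomputable section

namespace DiscreteGBM

/-- The law of one increment: the centred normal distribution with variance `Δt`. -/
def incrementLaw (Δt : ℝ) : Measure ℝ := gaussianReal 0 Δt.toNNReal

/-- The one-period return `ρ(y) = e^{σ y - r Δt} - 1`. -/
def ret (σ r Δt y : ℝ) : ℝ := Real.exp (σ * y - r * Δt) - 1

/-- The set of increments with a nonpositive return. -/
def omegaMinus (σ r Δt : ℝ) : Set ℝ := {y | ret σ r Δt y ≤ 0}

/-- The set of increments with a positive return. -/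
def omegaPlus (σ r Δt : ℝ) : Set ℝ := {y | 0 < ret σ r Δt y}

/-- The product `P⁻ × P⁺` of the restrictions of the increment law to the two sets. -/
def pairMeasure (σ r Δt : ℝ) : Measure (ℝ × ℝ) :=
  ((incrementLaw Δt).restrict (omegaMinus σ r Δt)).prod
    ((incrementLaw Δt).restrict (omegaPlus σ r Δt))

/-- The weight `ρ⁺(y₂) / (ρ⁻(y₁) + ρ⁺(y₂))` of the first point. -/
def weightMinus (σ r Δt : ℝ) (p : ℝ × ℝ) : ℝ :=
  max (ret σ r Δt p.2) 0 / (max (-ret σ r Δt p.1) 0 + max (ret σ r Δt p.2) 0)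

/-- The weight `ρ⁻(y₁) / (ρ⁻(y₁) + ρ⁺(y₂))` of the second point. -/
def weightPlus (σ r Δt : ℝ) (p : ℝ × ℝ) : ℝ :=
  max (-ret σ r Δt p.1) 0 / (max (-ret σ r Δt p.1) 0 + max (ret σ r Δt p.2) 0)

/-- Admissible mixing densities `α` on the product of the two sets. -/
structure IsMixingDensity (σ r Δt : ℝ) (α : ℝ × ℝ → ℝ) : Prop where
  measurable : Measurable α
  nonneg : ∀ p, 0 ≤ α p
  positive : pairMeasure σ r Δt {p | 0 < α p} =
    incrementLaw Δt (omegaPlus σ r Δt) * incrementLaw Δt (omegaMinus σ r Δt)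
  finite : ∫⁻ p, ENNReal.ofReal (α p *
      (max (-ret σ r Δt p.1) 0 * max (ret σ r Δt p.2) 0 /
        (max (-ret σ r Δt p.1) 0 + max (ret σ r Δt p.2) 0))) ∂(pairMeasure σ r Δt) < ⊤
  total : ∫⁻ p, ENNReal.ofReal (α p) ∂(pairMeasure σ r Δt) = 1

/-- The set of one-period measures: mixtures of two-point measures with an admissible density. -/
def onePeriodMeasures (σ r Δt : ℝ) : Set (Measure ℝ) :=
  {Q | ∃ α : ℝ × ℝ → ℝ, IsMixingDensity σ r Δt α ∧ ∀ A : Set ℝ, MeasurableSet A →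
    Q A =
      ∫⁻ p, A.indicator 1 p.1 * ENNReal.ofReal (α p * weightMinus σ r Δt p)
          ∂(pairMeasure σ r Δt) +
      ∫⁻ p, A.indicator 1 p.2 * ENNReal.ofReal (α p * weightPlus σ r Δt p)
          ∂(pairMeasure σ r Δt)}

/-- The set of `N`-fold products of one-period measures. -/
def productMeasures (N : ℕ) (σ r Δt : ℝ) : Set (Measure (Fin N → ℝ)) :=
  {Q | ∃ q : Fin N → Measure ℝ, (∀ i, q i ∈ onePeriodMeasures σ r Δt) ∧ Q = Measure.pi q}

/-- The convex span of the product measures. -/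
def martingaleMeasures (N : ℕ) (σ r Δt : ℝ) : Set (Measure (Fin N → ℝ)) :=
  convexHull NNReal (productMeasures N σ r Δt)

/-- The random walk `ζ_n = y_1 + ⋯ + y_n` along a path of increments. -/
def walk {N : ℕ} (n : ℕ) (y : Fin N → ℝ) : ℝ :=
  ∑ i ∈ Finset.univ.filter (fun i : Fin N => (i : ℕ) < n), y i

/-- The discounted price `S_n = S_0 e^{σ ζ_n - n r Δt}`. -/
def price {N : ℕ} (S₀ σ r Δt : ℝ) (n : ℕ) (y : Fin N → ℝ) : ℝ :=
  S₀ * Real.exp (σ * walk n y - n * r * Δt)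

/-- The set of expectations `E^Q f(S_N)`, with `Q` in the convex span. -/
def expectations (N : ℕ) (S₀ σ r Δt : ℝ) (f : ℝ → ℝ) : Set ℝ :=
  {x | ∃ Q ∈ martingaleMeasures N σ r Δt, x = ∫ y, f (price S₀ σ r Δt N y) ∂Q}

/-- The number `d = - r Δt / σ`. -/
def shift (σ r Δt : ℝ) : ℝ := -(r * Δt) / σ

/-- The sum over all `2^N` branches determined by the points `y s 0`, `y s 1`.
Addition in `Fin 2` is cyclic. -/
def branchSum (N : ℕ) (S₀ σ r Δt : ℝ) (f : ℝ → ℝ) (y : Fin N → Fin 2 → ℝ) : ℝ :=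
  ∑ i : Fin N → Fin 2,
    f (S₀ * ∏ s, (1 + ret σ r Δt (y s (i s)))) *
      ∏ s, |Real.exp (σ * (shift σ r Δt + y s (i s + 1))) - 1| /
        |Real.exp (σ * (shift σ r Δt + y s (i s + 1))) -
          Real.exp (σ * (shift σ r Δt + y s (i s)))|

/-- The values of the branch sum over all points with `y s 0 ≤ -d < y s 1`. -/
def branchValues (N : ℕ) (S₀ σ r Δt : ℝ) (f : ℝ → ℝ) : Set ℝ :=
  {x | ∃ y : Fin N → Fin 2 → ℝ,
    (∀ s, y s 0 ≤ -shift σ r Δt ∧ -shift σ r Δt < y s 1) ∧ x = branchSum N S₀ σ r Δt f y}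

/-- No value of `f` at a positive price is an upward spike on a null set: near every `x > 0`,
`f` exceeds `f x - ε` on a set of positive Lebesgue measure. It holds, for instance, if `f` is
lower semicontinuous, right-continuous, left-continuous or monotone on the positive half-line. -/
def NoNullSpikes (f : ℝ → ℝ) : Prop :=
  ∀ x, 0 < x → ∀ ε, 0 < ε → ∀ δ, 0 < δ → 0 < volume {z | |z - x| < δ ∧ f x - ε < f z}

end DiscreteGBM

end

/-!
Both suprema equal the least capital of a static super-hedge, that is, the least `V` for which some
affine function through `(S₀, V)` dominates `f` on the positive prices. The branch weights are
probabilities that centre the returns, so such a `V` bounds the branch sums as well as the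
expectations. Conversely, if the branch sums are at most `V`, choosing trivial pairs in all periods
but the first yields the inequality for `f` at two prices on either side of `S₀`; it says that the
slopes from `(S₀, V)` to the graph of `f` on the left exceed those on the right, and any number in
between is the slope of a super-hedge.

If instead the expectations are at most `V`, product laws whose increments after the first period
are concentrated near the zero-return increment reduce the problem to one period, up to a small
shift of the increment. Taking the two points of the first period uniformly distributed on two
shrinking intervals, Lebesgue's differentiation theorem gives the same two-point inequality at
almost all increments. The resulting super-hedge dominates `f` almost everywhere, hence everywhere,
because `f` has no upward spikes on null sets.
-/

open scoped ENNReal NNReal Topology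

section HasIntegralLE

variable {X : Type*} [MeasurableSpace X] {F : X → ℝ} {V : ℝ}

/-- The function `F` is integrable with integral at most `V`: the Bochner integral alone would
not do, being `0` for a function that is not integrable. -/
def HasIntegralLE (F : X → ℝ) (μ : Measure X) (V : ℝ) : Prop :=
  Integrable F μ ∧ ∫ x, F x ∂μ ≤ V

lemma integrable_nnreal_smul_measure_iff {c : ℝ≥0} (hc : c ≠ 0) {μ : Measure X} :
    Integrable F (c • μ) ↔ Integrable F μ :=
  integrable_smul_measure (ENNReal.coe_ne_zero.2 hc) ENNReal.coe_ne_top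

lemma hasIntegralLE_smul_iff {c : ℝ≥0} (hc : c ≠ 0) {μ : Measure X} :
    HasIntegralLE F (c • μ) V ↔ HasIntegralLE F μ (V / c) := by
  rw [HasIntegralLE, HasIntegralLE, integrable_nnreal_smul_measure_iff hc,
    integral_smul_nnreal_measure, le_div_iff₀' (NNReal.coe_pos.2 (pos_iff_ne_zero.2 hc)),
    NNReal.smul_def, smul_eq_mul]

lemma convex_setOf_hasIntegralLE : Convex ℝ≥0 {μ : Measure X | HasIntegralLE F μ V} := by
  rintro μ ⟨hμ, hμV⟩ ν ⟨hν, hνV⟩ a b - - hab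
  have hμa : Integrable F (a • μ) := hμ.smul_measure_nnreal
  have hνb : Integrable F (b • ν) := hν.smul_measure_nnreal
  refine ⟨hμa.add_measure hνb, ?_⟩
  rw [integral_add_measure hμa hνb, integral_smul_nnreal_measure, integral_smul_nnreal_measure]
  calc (a : ℝ) * ∫ x, F x ∂μ + b * ∫ x, F x ∂ν
      ≤ a * V + b * V := by gcongr
    _ = V := by rw [← add_mul, ← NNReal.coe_add, hab, NNReal.coe_one, one_mul]

lemma HasIntegralLE.of_openSegment_subset {μ ν : Measure X}
    (h : openSegment ℝ≥0 μ ν ⊆ {ξ | HasIntegralLE F ξ V}) : HasIntegralLE F μ V := by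
  have hmid : Integrable F ((2⁻¹ : ℝ≥0) • μ + (2⁻¹ : ℝ≥0) • ν) :=
    (h ⟨2⁻¹, 2⁻¹, by norm_num, by norm_num, by rw [← two_mul]; norm_num, rfl⟩).1
  have hμ : Integrable F μ :=
    (integrable_nnreal_smul_measure_iff (by norm_num)).1 hmid.left_of_add_measure
  have hν : Integrable F ν :=
    (integrable_nnreal_smul_measure_iff (by norm_num)).1 hmid.right_of_add_measure
  have hseg : openSegment ℝ (∫ x, F x ∂μ) (∫ x, F x ∂ν) ⊆ Set.Iic V := by
    rintro _ ⟨a, b, ha, hb, hab, rfl⟩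
    lift a to ℝ≥0 using ha.le
    lift b to ℝ≥0 using hb.le
    have hξ := (h ⟨a, b, mod_cast ha, mod_cast hb, mod_cast hab, rfl⟩).2
    rwa [integral_add_measure hμ.smul_measure_nnreal hν.smul_measure_nnreal,
      integral_smul_nnreal_measure, integral_smul_nnreal_measure] at hξ
  exact ⟨hμ, closure_minimal hseg isClosed_Iic
    (segment_subset_closure_openSegment (left_mem_segment ..))⟩

section Pi

variable {ι : Type*} [Fintype ι] {Y : ι → Type*} [∀ i, MeasurableSpace (Y i)]

lemma pi_update_smul_add_smul [DecidableEq ι] (q : ∀ i, Measure (Y i)) [∀ i, IsFiniteMeasure (q i)]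
    (i : ι) (μ ν : Measure (Y i)) [IsFiniteMeasure μ] [IsFiniteMeasure ν] (a b : ℝ≥0) :
    Measure.pi (Function.update q i (a • μ + b • ν)) =
      a • Measure.pi (Function.update q i μ) + b • Measure.pi (Function.update q i ν) := by
  have hfinite : ∀ (ξ : Measure (Y i)) [IsFiniteMeasure ξ] (j : ι),
      IsFiniteMeasure (Function.update q i ξ j) := fun ξ _ =>
    (Function.forall_update_iff q (p := fun _ m => IsFiniteMeasure m)).2
      ⟨inferInstance, fun _ _ => inferInstance⟩
  have hbox : ∀ (ξ : Measure (Y i)) (s : ∀ j, Set (Y j)),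
      ∏ j, Function.update q i ξ j (s j) = ξ (s i) * ∏ j ∈ Finset.univ \ {i}, q j (s j) := by
    intro ξ s
    simp only [Function.apply_update (fun j (m : Measure (Y j)) => m (s j)),
      Finset.prod_update_of_mem (Finset.mem_univ i)]
  have := hfinite μ
  have := hfinite ν
  have := hfinite (a • μ + b • ν)
  refine Measure.pi_eq fun s _ => ?_
  simp only [Measure.add_apply, Measure.smul_apply, ENNReal.smul_def, smul_eq_mul,
    Measure.pi_pi, hbox]
  ring

lemma HasIntegralLE.pi_of_openSegment {F : (∀ i, Y i) → ℝ} {q q₀ : ∀ i, Measure (Y i)}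
    [∀ i, IsFiniteMeasure (q i)] [∀ i, IsFiniteMeasure (q₀ i)]
    (h : ∀ p : ∀ i, Measure (Y i), (∀ i, p i ∈ openSegment ℝ≥0 (q i) (q₀ i)) →
      HasIntegralLE F (Measure.pi p) V) : HasIntegralLE F (Measure.pi q) V := by
  classical
  suffices hpartial : ∀ (s : Finset ι) (p : ∀ i, Measure (Y i)), (∀ i ∈ s, p i = q i) →
      (∀ i ∉ s, p i ∈ openSegment ℝ≥0 (q i) (q₀ i)) → HasIntegralLE F (Measure.pi p) V from
    hpartial Finset.univ q (fun _ _ => rfl) fun i hi => absurd (Finset.mem_univ i) hi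
  intro s
  induction s using Finset.induction_on with
  | empty => exact fun p _ hp => h p fun i => hp i (Finset.notMem_empty i)
  | insert i s hi ih =>
    intro p hpq hp
    have hfinite : ∀ j, IsFiniteMeasure (p j) := by
      intro j
      by_cases hj : j ∈ insert i s
      · rw [hpq j hj]
        infer_instance
      · obtain ⟨a, b, -, -, -, hab⟩ := hp j hj
        rw [← hab]
        infer_instance
    have hseg : openSegment ℝ≥0 (Measure.pi p) (Measure.pi (Function.update p i (q₀ i))) ⊆
        {ξ | HasIntegralLE F ξ V} := by
      rintro _ ⟨a, b, ha, hb, hab, rfl⟩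
      have hpi : Function.update p i (q i) = p := by
        rw [← hpq i (Finset.mem_insert_self i s), Function.update_eq_self]
      nth_rewrite 1 [← hpi]
      rw [← pi_update_smul_add_smul]
      refine ih _ (fun j hj => ?_) fun j hj => ?_
      · have hji : j ≠ i := fun hji => hi (hji ▸ hj)
        rw [Function.update_of_ne hji, hpq j (Finset.mem_insert_of_mem hj)]
      · rcases eq_or_ne j i with rfl | hji
        · rw [Function.update_self]
          exact ⟨a, b, ha, hb, hab, rfl⟩
        · rw [Function.update_of_ne hji]
          exact hp j (by simp [hji, hj])
    exact HasIntegralLE.of_openSegment_subset hseg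

end Pi

section Sections

variable {Z : Type*} [MeasurableSpace Z]

lemma HasIntegralLE.exists_section {μ : Measure X} {ν : Measure Z} [SFinite μ]
    [IsProbabilityMeasure ν] {G : X × Z → ℝ} (hG : HasIntegralLE G (μ.prod ν) V)
    {p : Z → Prop} (hp : ∀ᵐ z ∂ν, p z) :
    ∃ z, p z ∧ HasIntegralLE (fun x => G (x, z)) μ V := by
  have hgood : ∀ᵐ z ∂ν, p z ∧ Integrable (fun x => G (x, z)) μ := hp.and hG.1.prod_left_ae
  obtain ⟨z, hz, hzle⟩ :=
    exists_notMem_null_le_integral hG.1.integral_prod_right (ae_iff.1 hgood)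
  rw [Set.mem_ofPred_eq, not_not] at hz
  exact ⟨z, hz.1, hz.2, hzle.trans ((integral_prod_symm _ hG.1).ge.trans hG.2)⟩

lemma HasIntegralLE.exists_cons {n : ℕ} {F : (Fin (n + 1) → X) → ℝ}
    {q : Fin (n + 1) → Measure X} [∀ i, IsProbabilityMeasure (q i)]
    (hF : HasIntegralLE F (Measure.pi q) V) {p : (Fin n → X) → Prop}
    (hp : ∀ᵐ u ∂(Measure.pi fun j : Fin n => q j.succ), p u) :
    ∃ u, p u ∧ HasIntegralLE (fun x => F (Fin.cons x u)) (q 0) V := by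
  have hpres := (measurePreserving_piFinSuccAbove q 0).symm
  have hemb :=
    (MeasurableEquiv.piFinSuccAbove (fun _ : Fin (n + 1) => X) 0).symm.measurableEmbedding
  have hcons : F ∘ (MeasurableEquiv.piFinSuccAbove (fun _ : Fin (n + 1) => X) 0).symm =
      fun z => F (Fin.cons z.1 z.2) := by
    ext z
    exact congrArg F (Fin.insertNth_zero' z.1 z.2)
  have hG : HasIntegralLE (fun z : X × (Fin n → X) => F (Fin.cons z.1 z.2))
      ((q 0).prod (Measure.pi fun j : Fin n => q j.succ)) V := by
    rw [← hcons]
    exact ⟨(hpres.integrable_comp_emb hemb).2 hF.1, (hpres.integral_comp hemb F).le.trans hF.2⟩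
  exact hG.exists_section hp

end Sections

end HasIntegralLE

section Chord

lemma exists_affine_majorant_of_chord_le {s : Set ℝ} {g : ℝ → ℝ} {c V : ℝ}
    (hlt : ∃ x ∈ s, x < c) (hgt : ∃ y ∈ s, c < y)
    (hchord : ∀ x ∈ s, ∀ y ∈ s, x ≤ c → c < y →
      (y - c) * g x + (c - x) * g y ≤ V * (y - x)) :
    ∃ m, ∀ x ∈ s, g x ≤ V + m * (x - c) := by
  obtain ⟨x₀, hx₀, hx₀c⟩ := hlt
  obtain ⟨y₀, hy₀, hcy₀⟩ := hgt
  have hslope : ∀ y ∈ {y | y ∈ s ∧ c < y}, ∀ x ∈ {x | x ∈ s ∧ x < c},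
      (g y - V) / (y - c) ≤ (V - g x) / (c - x) := by
    rintro y ⟨hy, hcy⟩ x ⟨hx, hxc⟩
    rw [div_le_div_iff₀ (sub_pos.2 hcy) (sub_pos.2 hxc)]
    linarith [hchord x hx y hy hxc.le hcy]
  obtain ⟨m, hm, hm'⟩ := exists_between_of_forall_le
    (Set.Nonempty.image (fun y => (g y - V) / (y - c)) (s := {y | y ∈ s ∧ c < y}) ⟨y₀, hy₀, hcy₀⟩)
    (Set.Nonempty.image (fun x => (V - g x) / (c - x)) (s := {x | x ∈ s ∧ x < c}) ⟨x₀, hx₀, hx₀c⟩)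
    (Set.forall_mem_image.2 fun y hy => Set.forall_mem_image.2 fun x hx => hslope y hy x hx)
  refine ⟨m, fun x hx => ?_⟩
  rcases lt_trichotomy x c with hxc | rfl | hcx
  · have := (le_div_iff₀ (sub_pos.2 hxc)).1 (hm' (Set.mem_image_of_mem _ ⟨hx, hxc⟩))
    linarith
  · have := hchord x hx y₀ hy₀ le_rfl hcy₀
    rw [sub_self, zero_mul, add_zero, mul_comm] at this
    simpa using le_of_mul_le_mul_right this (sub_pos.2 hcy₀)
  · have := (div_le_iff₀ (sub_pos.2 hcx)).1 (hm (Set.mem_image_of_mem _ ⟨hx, hcx⟩))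
    linarith

end Chord

namespace DiscreteGBM

section Return

variable {σ r Δt : ℝ}

lemma one_add_ret (y : ℝ) : 1 + ret σ r Δt y = Real.exp (σ * y - r * Δt) := by
  rw [ret, add_sub_cancel]

lemma one_add_ret_pos (y : ℝ) : 0 < 1 + ret σ r Δt y := by
  rw [one_add_ret]
  positivity

lemma continuous_ret : Continuous (ret σ r Δt) := by
  unfold ret
  fun_prop

lemma measurable_ret : Measurable (ret σ r Δt) := continuous_ret.measurable

lemma hasDerivAt_ret (y : ℝ) : HasDerivAt (ret σ r Δt) (σ * (1 + ret σ r Δt y)) y := by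
  have hexponent : HasDerivAt (fun y => σ * y - r * Δt) σ y := by
    simpa using ((hasDerivAt_id y).const_mul σ).sub_const (r * Δt)
  rw [one_add_ret, mul_comm]
  exact hexponent.exp.sub_const 1

lemma strictMono_ret (hσ : 0 < σ) : StrictMono (ret σ r Δt) :=
  strictMono_of_hasDerivAt_pos hasDerivAt_ret fun y => mul_pos hσ (one_add_ret_pos y)

lemma ret_neg_shift (hσ : 0 < σ) : ret σ r Δt (-shift σ r Δt) = 0 := by
  rw [ret, shift, neg_div, neg_neg, mul_div_cancel₀ _ hσ.ne', sub_self, Real.exp_zero, sub_self]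

lemma ret_nonpos_iff (hσ : 0 < σ) {y : ℝ} : ret σ r Δt y ≤ 0 ↔ y ≤ -shift σ r Δt := by
  rw [← ret_neg_shift (r := r) (Δt := Δt) hσ, (strictMono_ret hσ).le_iff_le]

lemma ret_pos_iff (hσ : 0 < σ) {y : ℝ} : 0 < ret σ r Δt y ↔ -shift σ r Δt < y := by
  rw [← ret_neg_shift (r := r) (Δt := Δt) hσ, (strictMono_ret hσ).lt_iff_lt]

lemma omegaMinus_eq (hσ : 0 < σ) : omegaMinus σ r Δt = Set.Iic (-shift σ r Δt) :=
  Set.ext fun _ => ret_nonpos_iff hσ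

lemma omegaPlus_eq (hσ : 0 < σ) : omegaPlus σ r Δt = Set.Ioi (-shift σ r Δt) :=
  Set.ext fun _ => ret_pos_iff hσ

lemma measurableSet_omegaMinus : MeasurableSet (omegaMinus σ r Δt) :=
  measurableSet_le measurable_ret measurable_const

lemma measurableSet_omegaPlus : MeasurableSet (omegaPlus σ r Δt) :=
  measurableSet_lt measurable_const measurable_ret

end Return

section Weights

variable {σ r Δt : ℝ} {p : ℝ × ℝ}

lemma measurable_weightMinus : Measurable (weightMinus σ r Δt) := by
  have := measurable_ret (σ := σ) (r := r) (Δt := Δt)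
  unfold weightMinus
  fun_prop

lemma measurable_weightPlus : Measurable (weightPlus σ r Δt) := by
  have := measurable_ret (σ := σ) (r := r) (Δt := Δt)
  unfold weightPlus
  fun_prop

lemma weightMinus_nonneg (p : ℝ × ℝ) : 0 ≤ weightMinus σ r Δt p := by
  unfold weightMinus
  positivity

lemma weightPlus_nonneg (p : ℝ × ℝ) : 0 ≤ weightPlus σ r Δt p := by
  unfold weightPlus
  positivity

lemma weightMinus_eq (hp : p ∈ omegaMinus σ r Δt ×ˢ omegaPlus σ r Δt) :
    weightMinus σ r Δt p = ret σ r Δt p.2 / (ret σ r Δt p.2 - ret σ r Δt p.1) := by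
  rw [weightMinus, max_eq_left (neg_nonneg.2 hp.1), max_eq_left (le_of_lt hp.2), neg_add_eq_sub]

lemma weightPlus_eq (hp : p ∈ omegaMinus σ r Δt ×ˢ omegaPlus σ r Δt) :
    weightPlus σ r Δt p = -ret σ r Δt p.1 / (ret σ r Δt p.2 - ret σ r Δt p.1) := by
  rw [weightPlus, max_eq_left (neg_nonneg.2 hp.1), max_eq_left (le_of_lt hp.2), neg_add_eq_sub]

lemma ret_sub_ret_pos (hp : p ∈ omegaMinus σ r Δt ×ˢ omegaPlus σ r Δt) :
    0 < ret σ r Δt p.2 - ret σ r Δt p.1 :=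
  sub_pos.2 (lt_of_le_of_lt hp.1 hp.2)

lemma weightMinus_add_weightPlus (hp : p ∈ omegaMinus σ r Δt ×ˢ omegaPlus σ r Δt) :
    weightMinus σ r Δt p + weightPlus σ r Δt p = 1 := by
  rw [weightMinus_eq hp, weightPlus_eq hp, ← add_div, ← sub_eq_add_neg,
    div_self (ret_sub_ret_pos hp).ne']

lemma one_add_ret_mul_weights (hp : p ∈ omegaMinus σ r Δt ×ˢ omegaPlus σ r Δt) :
    (1 + ret σ r Δt p.1) * weightMinus σ r Δt p +
      (1 + ret σ r Δt p.2) * weightPlus σ r Δt p = 1 := by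
  have := (ret_sub_ret_pos hp).ne'
  rw [weightMinus_eq hp, weightPlus_eq hp]
  field_simp
  ring

end Weights

section Price

variable {σ r Δt S₀ : ℝ}

lemma price_eq_prod {N : ℕ} (y : Fin N → ℝ) :
    price S₀ σ r Δt N y = S₀ * ∏ i, (1 + ret σ r Δt (y i)) := by
  simp only [price, walk, one_add_ret, ← Real.exp_sum, Finset.sum_sub_distrib, Finset.mul_sum]
  simp [mul_assoc]

lemma price_cons (hσ : 0 < σ) {n : ℕ} (x : ℝ) (u : Fin n → ℝ) :
    price S₀ σ r Δt (n + 1) (Fin.cons x u) =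
      S₀ * (1 + ret σ r Δt (x + ∑ j, (u j + shift σ r Δt))) := by
  have hshift : σ * shift σ r Δt = -(r * Δt) := mul_div_cancel₀ _ hσ.ne'
  have hexponent : σ * (x + ∑ j, (u j + shift σ r Δt)) - r * Δt =
      σ * x - r * Δt + ∑ j, (σ * u j - r * Δt) := by
    simp only [mul_add, Finset.mul_sum, hshift, ← sub_eq_add_neg]
    ring
  simp only [price_eq_prod, one_add_ret, ← Real.exp_sum, Fin.sum_univ_succ, Fin.cons_zero,
    Fin.cons_succ, hexponent]

lemma exists_mul_one_add_ret_eq (hσ : 0 < σ) (hS₀ : 0 < S₀) {x : ℝ} (hx : 0 < x) :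
    ∃ t, S₀ * (1 + ret σ r Δt t) = x := by
  refine ⟨(Real.log (x / S₀) + r * Δt) / σ, ?_⟩
  rw [one_add_ret, mul_div_cancel₀ _ hσ.ne', add_sub_cancel_right, Real.exp_log (div_pos hx hS₀),
    mul_div_cancel₀ _ hS₀.ne']

end Price

section TwoPointMixture

variable {σ r Δt : ℝ}

/-- The law of the point drawn from `{p.1, p.2}` with the weights that make the return centred,
where the pair `p` is itself drawn from `κ`. -/
noncomputable def twoPointMixture (σ r Δt : ℝ) (κ : Measure (ℝ × ℝ)) : Measure ℝ :=
  (κ.withDensity fun p => ENNReal.ofReal (weightMinus σ r Δt p)).map Prod.fst +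
    (κ.withDensity fun p => ENNReal.ofReal (weightPlus σ r Δt p)).map Prod.snd

lemma twoPointMixture_add (κ κ' : Measure (ℝ × ℝ)) : twoPointMixture σ r Δt (κ + κ') =
    twoPointMixture σ r Δt κ + twoPointMixture σ r Δt κ' := by
  simp only [twoPointMixture, withDensity_add_measure, Measure.map_add _ _ measurable_fst,
    Measure.map_add _ _ measurable_snd]
  abel

lemma twoPointMixture_smul (c : ℝ≥0) (κ : Measure (ℝ × ℝ)) :
    twoPointMixture σ r Δt (c • κ) = c • twoPointMixture σ r Δt κ := by
  simp only [twoPointMixture, ENNReal.smul_def, withDensity_smul_measure, Measure.map_smul,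
    smul_add]

lemma lintegral_twoPointMixture (κ : Measure (ℝ × ℝ)) {g : ℝ → ℝ≥0∞} (hg : Measurable g) :
    ∫⁻ y, g y ∂(twoPointMixture σ r Δt κ) =
      ∫⁻ p, g p.1 * ENNReal.ofReal (weightMinus σ r Δt p) ∂κ +
        ∫⁻ p, g p.2 * ENNReal.ofReal (weightPlus σ r Δt p) ∂κ := by
  rw [twoPointMixture, lintegral_add_measure, lintegral_map hg measurable_fst,
    lintegral_map hg measurable_snd,
    lintegral_withDensity_eq_lintegral_mul _ measurable_weightMinus.ennreal_ofReal (by fun_prop),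
    lintegral_withDensity_eq_lintegral_mul _ measurable_weightPlus.ennreal_ofReal (by fun_prop)]
  simp only [Pi.mul_apply, mul_comm]

lemma ae_twoPointMixture {κ : Measure (ℝ × ℝ)} {A : Set ℝ} (hA : MeasurableSet A)
    (hκ : ∀ᵐ p ∂κ, p ∈ A ×ˢ A) : ∀ᵐ y ∂(twoPointMixture σ r Δt κ), y ∈ A := by
  refine ae_add_measure_iff.2 ⟨?_, ?_⟩
  · refine (ae_map_iff measurable_fst.aemeasurable hA).2 ?_
    exact (withDensity_absolutelyContinuous _ _).ae_le (hκ.mono fun p hp => hp.1)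
  · refine (ae_map_iff measurable_snd.aemeasurable hA).2 ?_
    exact (withDensity_absolutelyContinuous _ _).ae_le (hκ.mono fun p hp => hp.2)

section Martingale

variable {κ : Measure (ℝ × ℝ)}

lemma lintegral_twoPointMixture_eq_measure_univ
    (hκ : ∀ᵐ p ∂κ, p ∈ omegaMinus σ r Δt ×ˢ omegaPlus σ r Δt) {g : ℝ → ℝ} (hg : Measurable g)
    (hg_nonneg : ∀ y, 0 ≤ g y)
    (hmean : ∀ p ∈ omegaMinus σ r Δt ×ˢ omegaPlus σ r Δt,
      g p.1 * weightMinus σ r Δt p + g p.2 * weightPlus σ r Δt p = 1) :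
    ∫⁻ y, ENNReal.ofReal (g y) ∂(twoPointMixture σ r Δt κ) = κ Set.univ := by
  have hw := measurable_weightMinus (σ := σ) (r := r) (Δt := Δt)
  rw [lintegral_twoPointMixture _ hg.ennreal_ofReal, ← lintegral_add_left (by fun_prop),
    ← lintegral_one]
  refine lintegral_congr_ae ?_
  filter_upwards [hκ] with p hp
  rw [← ENNReal.ofReal_mul (hg_nonneg _), ← ENNReal.ofReal_mul (hg_nonneg _),
    ← ENNReal.ofReal_add (mul_nonneg (hg_nonneg _) (weightMinus_nonneg p))
      (mul_nonneg (hg_nonneg _) (weightPlus_nonneg p)), hmean p hp, ENNReal.ofReal_one]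

lemma twoPointMixture_univ (hκ : ∀ᵐ p ∂κ, p ∈ omegaMinus σ r Δt ×ˢ omegaPlus σ r Δt) :
    twoPointMixture σ r Δt κ Set.univ = κ Set.univ := by
  have hone := lintegral_twoPointMixture_eq_measure_univ hκ (g := fun _ => 1) measurable_const
    (fun _ => zero_le_one) fun p hp => by
      rw [one_mul, one_mul, weightMinus_add_weightPlus hp]
  simpa using hone

lemma isProbabilityMeasure_twoPointMixture [IsProbabilityMeasure κ]
    (hκ : ∀ᵐ p ∂κ, p ∈ omegaMinus σ r Δt ×ˢ omegaPlus σ r Δt) :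
    IsProbabilityMeasure (twoPointMixture σ r Δt κ) :=
  ⟨(twoPointMixture_univ hκ).trans measure_univ⟩

lemma hasIntegral_one_add_ret_twoPointMixture [IsProbabilityMeasure κ]
    (hκ : ∀ᵐ p ∂κ, p ∈ omegaMinus σ r Δt ×ˢ omegaPlus σ r Δt) :
    Integrable (fun y => 1 + ret σ r Δt y) (twoPointMixture σ r Δt κ) ∧
      ∫ y, (1 + ret σ r Δt y) ∂(twoPointMixture σ r Δt κ) = 1 := by
  have hmeas : Measurable fun y => 1 + ret σ r Δt y := measurable_ret.const_add 1
  have hnonneg : ∀ y, 0 ≤ 1 + ret σ r Δt y := fun y => (one_add_ret_pos y).le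
  have hone := lintegral_twoPointMixture_eq_measure_univ hκ hmeas hnonneg
    fun _ => one_add_ret_mul_weights
  rw [measure_univ] at hone
  refine ⟨⟨hmeas.aestronglyMeasurable, ?_⟩, ?_⟩
  · rw [hasFiniteIntegral_iff_ofReal (ae_of_all _ hnonneg), hone]
    exact ENNReal.one_lt_top
  · rw [integral_eq_lintegral_of_nonneg_ae (ae_of_all _ hnonneg) hmeas.aestronglyMeasurable, hone,
      ENNReal.toReal_one]

end Martingale

end TwoPointMixture

section OnePeriod

variable {σ r Δt : ℝ}

instance : IsProbabilityMeasure (incrementLaw Δt) :=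
  inferInstanceAs (IsProbabilityMeasure (gaussianReal _ _))

instance : IsFiniteMeasure (pairMeasure σ r Δt) := by
  unfold pairMeasure
  infer_instance

lemma ae_mem_pairMeasure :
    ∀ᵐ p ∂(pairMeasure σ r Δt), p ∈ omegaMinus σ r Δt ×ˢ omegaPlus σ r Δt := by
  rw [pairMeasure, Measure.prod_restrict]
  exact ae_restrict_mem (measurableSet_omegaMinus.prod measurableSet_omegaPlus)

lemma pairMeasure_univ : pairMeasure σ r Δt Set.univ =
    incrementLaw Δt (omegaPlus σ r Δt) * incrementLaw Δt (omegaMinus σ r Δt) := by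
  rw [pairMeasure, ← Set.univ_prod_univ, Measure.prod_prod, Measure.restrict_apply_univ,
    Measure.restrict_apply_univ, mul_comm]

lemma volume_absolutelyContinuous_incrementLaw (hΔt : 0 < Δt) : volume ≪ incrementLaw Δt :=
  gaussianReal_absolutelyContinuous' 0 (Real.toNNReal_pos.2 hΔt).ne'

lemma pairMeasure_ne_zero (hσ : 0 < σ) (hΔt : 0 < Δt) : pairMeasure σ r Δt ≠ 0 := by
  have hac := volume_absolutelyContinuous_incrementLaw hΔt
  rw [← Measure.measure_univ_ne_zero, pairMeasure_univ, omegaMinus_eq hσ, omegaPlus_eq hσ]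
  exact mul_ne_zero (fun h => by simpa using hac h) fun h => by simpa using hac h

lemma twoPointMixture_withDensity_apply {ν : Measure (ℝ × ℝ)} {α : ℝ × ℝ → ℝ} (hα : Measurable α)
    (hα_nonneg : ∀ p, 0 ≤ α p) {A : Set ℝ} (hA : MeasurableSet A) :
    twoPointMixture σ r Δt (ν.withDensity fun p => ENNReal.ofReal (α p)) A =
      ∫⁻ p, A.indicator 1 p.1 * ENNReal.ofReal (α p * weightMinus σ r Δt p) ∂ν +
        ∫⁻ p, A.indicator 1 p.2 * ENNReal.ofReal (α p * weightPlus σ r Δt p) ∂ν := by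
  have hw := measurable_weightMinus (σ := σ) (r := r) (Δt := Δt)
  have hw' := measurable_weightPlus (σ := σ) (r := r) (Δt := Δt)
  have hind : Measurable (A.indicator 1 : ℝ → ℝ≥0∞) := measurable_one.indicator hA
  rw [← lintegral_indicator_one hA, lintegral_twoPointMixture _ hind,
    lintegral_withDensity_eq_lintegral_mul _ hα.ennreal_ofReal (by fun_prop),
    lintegral_withDensity_eq_lintegral_mul _ hα.ennreal_ofReal (by fun_prop)]
  simp only [Pi.mul_apply, ENNReal.ofReal_mul (hα_nonneg _), mul_left_comm]

lemma harmonicWeight_le_one (p : ℝ × ℝ) :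
    max (-ret σ r Δt p.1) 0 * max (ret σ r Δt p.2) 0 /
      (max (-ret σ r Δt p.1) 0 + max (ret σ r Δt p.2) 0) ≤ 1 := by
  have hloss : max (-ret σ r Δt p.1) 0 ≤ 1 :=
    max_le (by linarith [one_add_ret_pos (σ := σ) (r := r) (Δt := Δt) p.1]) zero_le_one
  have hloss_nonneg : 0 ≤ max (-ret σ r Δt p.1) 0 := le_max_right _ _
  have hgain_nonneg : 0 ≤ max (ret σ r Δt p.2) 0 := le_max_right _ _
  exact div_le_one_of_le₀ (by nlinarith) (by positivity)

lemma isMixingDensity_iff {α : ℝ × ℝ → ℝ} (hα : Measurable α) (hα_nonneg : ∀ p, 0 ≤ α p) :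
    IsMixingDensity σ r Δt α ↔ (∀ᵐ p ∂(pairMeasure σ r Δt), 0 < α p) ∧
      IsProbabilityMeasure ((pairMeasure σ r Δt).withDensity fun p => ENNReal.ofReal (α p)) := by
  have hpos : (∀ᵐ p ∂(pairMeasure σ r Δt), 0 < α p) ↔ pairMeasure σ r Δt {p | 0 < α p} =
      incrementLaw Δt (omegaPlus σ r Δt) * incrementLaw Δt (omegaMinus σ r Δt) := by
    rw [← pairMeasure_univ,
      ae_iff_measure_eq (measurableSet_lt measurable_const hα).nullMeasurableSet]
  have htotal : IsProbabilityMeasure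
      ((pairMeasure σ r Δt).withDensity fun p => ENNReal.ofReal (α p)) ↔
      ∫⁻ p, ENNReal.ofReal (α p) ∂(pairMeasure σ r Δt) = 1 := by
    rw [isProbabilityMeasure_iff, withDensity_apply _ MeasurableSet.univ, Measure.restrict_univ]
  rw [hpos, htotal]
  refine ⟨fun h => ⟨h.positive, h.total⟩, fun h => ⟨hα, hα_nonneg, h.1, ?_, h.2⟩⟩
  calc ∫⁻ p, ENNReal.ofReal (α p * (max (-ret σ r Δt p.1) 0 * max (ret σ r Δt p.2) 0 /
        (max (-ret σ r Δt p.1) 0 + max (ret σ r Δt p.2) 0))) ∂(pairMeasure σ r Δt)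
      ≤ ∫⁻ p, ENNReal.ofReal (α p) ∂(pairMeasure σ r Δt) := by
        gcongr with p
        exact mul_le_of_le_one_right (hα_nonneg p) (harmonicWeight_le_one p)
    _ < ⊤ := h.2.trans_lt ENNReal.one_lt_top

lemma mem_onePeriodMeasures_iff {Q : Measure ℝ} : Q ∈ onePeriodMeasures σ r Δt ↔
    ∃ κ : Measure (ℝ × ℝ), IsProbabilityMeasure κ ∧ κ ≪ pairMeasure σ r Δt ∧
      pairMeasure σ r Δt ≪ κ ∧ Q = twoPointMixture σ r Δt κ := by
  constructor
  · rintro ⟨α, hα, hQ⟩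
    obtain ⟨hpos, hprob⟩ := (isMixingDensity_iff hα.measurable hα.nonneg).1 hα
    refine ⟨_, hprob, withDensity_absolutelyContinuous _ _, ?_, Measure.ext fun A hA => ?_⟩
    · exact withDensity_absolutelyContinuous' hα.measurable.ennreal_ofReal.aemeasurable
        (hpos.mono fun p hp => (ENNReal.ofReal_pos.2 hp).ne')
    · rw [hQ A hA, twoPointMixture_withDensity_apply hα.measurable hα.nonneg hA]
  · rintro ⟨κ, hκ, hac, hac', rfl⟩
    have hmeas : Measurable fun p => (κ.rnDeriv (pairMeasure σ r Δt) p).toReal :=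
      (Measure.measurable_rnDeriv κ _).ennreal_toReal
    have hdensity : (pairMeasure σ r Δt).withDensity
        (fun p => ENNReal.ofReal (κ.rnDeriv (pairMeasure σ r Δt) p).toReal) = κ := by
      rw [withDensity_congr_ae ((Measure.rnDeriv_lt_top κ _).mono fun p hp =>
        ENNReal.ofReal_toReal hp.ne), Measure.withDensity_rnDeriv_eq _ _ hac]
    have hpos : ∀ᵐ p ∂(pairMeasure σ r Δt), 0 < (κ.rnDeriv (pairMeasure σ r Δt) p).toReal := by
      filter_upwards [Measure.rnDeriv_pos' hac', Measure.rnDeriv_lt_top κ (pairMeasure σ r Δt)]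
        with p hp hp' using ENNReal.toReal_pos hp.ne' hp'.ne
    refine ⟨_, (isMixingDensity_iff hmeas fun p => ENNReal.toReal_nonneg).2
      ⟨hpos, by rwa [hdensity]⟩, fun A hA => ?_⟩
    rw [← twoPointMixture_withDensity_apply hmeas (fun p => ENNReal.toReal_nonneg) hA, hdensity]

end OnePeriod

section Closure

variable {σ r Δt V : ℝ}

lemma openSegment_twoPointMixture_subset {κ κ₀ : Measure (ℝ × ℝ)} [IsProbabilityMeasure κ]
    [IsProbabilityMeasure κ₀] (hκ : κ ≪ pairMeasure σ r Δt) (hκ₀ : κ₀ ≪ pairMeasure σ r Δt)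
    (hκ₀' : pairMeasure σ r Δt ≪ κ₀) :
    openSegment ℝ≥0 (twoPointMixture σ r Δt κ) (twoPointMixture σ r Δt κ₀) ⊆
      onePeriodMeasures σ r Δt := by
  rintro _ ⟨a, b, -, hb, hab, rfl⟩
  refine mem_onePeriodMeasures_iff.2 ⟨a • κ + b • κ₀, ⟨?_⟩, ?_, ?_, ?_⟩
  · simp only [Measure.add_apply, Measure.smul_apply, measure_univ, ENNReal.smul_def, smul_eq_mul,
      mul_one]
    exact_mod_cast hab
  · exact Measure.AbsolutelyContinuous.add_left (hκ.smul_left a) (hκ₀.smul_left b)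
  · have hsmul : κ₀ ≪ b • κ₀ := Measure.absolutelyContinuous_smul (ENNReal.coe_ne_zero.2 hb.ne')
    exact hκ₀'.trans (hsmul.trans (Measure.le_add_left le_rfl).absolutelyContinuous)
  · rw [twoPointMixture_add, twoPointMixture_smul, twoPointMixture_smul]

lemma exists_isProbabilityMeasure_pairMeasure (hσ : 0 < σ) (hΔt : 0 < Δt) :
    ∃ κ₀ : Measure (ℝ × ℝ), IsProbabilityMeasure κ₀ ∧ κ₀ ≪ pairMeasure σ r Δt ∧
      pairMeasure σ r Δt ≪ κ₀ :=
  ⟨(pairMeasure σ r Δt)[|Set.univ],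
    cond_isProbabilityMeasure (Measure.measure_univ_ne_zero.2 (pairMeasure_ne_zero hσ hΔt)),
    cond_absolutelyContinuous, absolutelyContinuous_cond_univ⟩

lemma nonempty_onePeriodMeasures (hσ : 0 < σ) (hΔt : 0 < Δt) :
    (onePeriodMeasures σ r Δt).Nonempty := by
  obtain ⟨κ₀, hprob, hκ₀, hκ₀'⟩ := exists_isProbabilityMeasure_pairMeasure (r := r) hσ hΔt
  exact ⟨_, mem_onePeriodMeasures_iff.2 ⟨κ₀, hprob, hκ₀, hκ₀', rfl⟩⟩

-- A mixture of pairs whose law is not equivalent to `pairMeasure` is only a limit of one-period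
-- measures: it is the endpoint of an open segment of them.
lemma hasIntegralLE_pi_twoPointMixture (hσ : 0 < σ) (hΔt : 0 < Δt) {ι : Type*} [Fintype ι]
    {F : (ι → ℝ) → ℝ}
    (hF : ∀ q : ι → Measure ℝ, (∀ i, q i ∈ onePeriodMeasures σ r Δt) →
      HasIntegralLE F (Measure.pi q) V)
    {κ : ι → Measure (ℝ × ℝ)} [∀ i, IsProbabilityMeasure (κ i)]
    (hκ : ∀ i, κ i ≪ pairMeasure σ r Δt) :
    HasIntegralLE F (Measure.pi fun i => twoPointMixture σ r Δt (κ i)) V := by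
  obtain ⟨κ₀, hprob, hκ₀, hκ₀'⟩ := exists_isProbabilityMeasure_pairMeasure (r := r) hσ hΔt
  have := fun i => isProbabilityMeasure_twoPointMixture ((hκ i).ae_le ae_mem_pairMeasure)
  have := isProbabilityMeasure_twoPointMixture (hκ₀.ae_le ae_mem_pairMeasure)
  refine HasIntegralLE.pi_of_openSegment (q₀ := fun _ => twoPointMixture σ r Δt κ₀) fun p hp => ?_
  exact hF p fun i => openSegment_twoPointMixture_subset (hκ i) hκ₀ hκ₀' (hp i)

end Closure

section ProductLaws

variable {σ r Δt : ℝ} {μ ν : Measure ℝ}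

lemma ofReal_mul_weightMinus (p : ℝ × ℝ) :
    ENNReal.ofReal (max (-ret σ r Δt p.1) 0 + max (ret σ r Δt p.2) 0) *
      ENNReal.ofReal (weightMinus σ r Δt p) = ENNReal.ofReal (ret σ r Δt p.2) := by
  have hloss : 0 ≤ max (-ret σ r Δt p.1) 0 := le_max_right _ _
  have hgain : 0 ≤ max (ret σ r Δt p.2) 0 := le_max_right _ _
  rw [← ENNReal.ofReal_mul (add_nonneg hloss hgain), weightMinus,
    mul_div_cancel_of_imp' fun hzero => by linarith]
  simp

lemma ofReal_mul_weightPlus (p : ℝ × ℝ) :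
    ENNReal.ofReal (max (-ret σ r Δt p.1) 0 + max (ret σ r Δt p.2) 0) *
      ENNReal.ofReal (weightPlus σ r Δt p) = ENNReal.ofReal (-ret σ r Δt p.1) := by
  have hloss : 0 ≤ max (-ret σ r Δt p.1) 0 := le_max_right _ _
  have hgain : 0 ≤ max (ret σ r Δt p.2) 0 := le_max_right _ _
  rw [← ENNReal.ofReal_mul (add_nonneg hloss hgain), weightPlus,
    mul_div_cancel_of_imp' fun hzero => by linarith]
  simp

-- The density is the common denominator of the two weights; cancelling it decouples the points.
lemma twoPointMixture_withDensity_prod (μ ν : Measure ℝ) [SFinite ν] :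
    twoPointMixture σ r Δt ((μ.prod ν).withDensity fun p =>
        ENNReal.ofReal (max (-ret σ r Δt p.1) 0 + max (ret σ r Δt p.2) 0)) =
      (∫⁻ y, ENNReal.ofReal (ret σ r Δt y) ∂ν) • μ +
        (∫⁻ y, ENNReal.ofReal (-ret σ r Δt y) ∂μ) • ν := by
  have hret := measurable_ret (σ := σ) (r := r) (Δt := Δt)
  have hgain : Measurable fun y => ENNReal.ofReal (ret σ r Δt y) := by fun_prop
  have hloss : Measurable fun y => ENNReal.ofReal (-ret σ r Δt y) := by fun_prop
  rw [twoPointMixture, ← withDensity_mul _ (by fun_prop) measurable_weightMinus.ennreal_ofReal,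
    ← withDensity_mul _ (by fun_prop) measurable_weightPlus.ennreal_ofReal,
    funext (f := _ * _) ofReal_mul_weightMinus, funext (f := _ * _) ofReal_mul_weightPlus,
    ← prod_withDensity_right hgain, ← prod_withDensity_left hloss, Measure.map_fst_prod,
    Measure.map_snd_prod, withDensity_apply _ MeasurableSet.univ,
    withDensity_apply _ MeasurableSet.univ, Measure.restrict_univ, Measure.restrict_univ]

lemma prod_absolutelyContinuous_pairMeasure (hΔt : 0 < Δt)
    (hμ : μ ≪ volume.restrict (omegaMinus σ r Δt)) (hν : ν ≪ volume.restrict (omegaPlus σ r Δt)) :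
    μ.prod ν ≪ pairMeasure σ r Δt :=
  have hac := volume_absolutelyContinuous_incrementLaw hΔt
  (hμ.trans (hac.restrict _)).prod (hν.trans (hac.restrict _))

lemma cond_absolutelyContinuous_restrict {s t : Set ℝ} (hst : s ⊆ t) :
    volume[|s] ≪ volume.restrict t :=
  Measure.smul_absolutelyContinuous.trans (Measure.restrict_mono hst le_rfl).absolutelyContinuous

lemma exists_concentrated_twoPointMixture (hσ : 0 < σ) (hΔt : 0 < Δt) {ε : ℝ} (hε : 0 < ε) :
    ∃ κ : Measure (ℝ × ℝ), IsProbabilityMeasure κ ∧ κ ≪ pairMeasure σ r Δt ∧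
      ∀ᵐ y ∂(twoPointMixture σ r Δt κ), |y + shift σ r Δt| ≤ ε := by
  obtain ⟨D, hD⟩ : ∃ D, -shift σ r Δt = D := ⟨_, rfl⟩
  have hμ : IsProbabilityMeasure volume[|Set.Icc (D - ε) D] :=
    cond_isProbabilityMeasure_of_finite (by simpa using hε) (by simp)
  have hν : IsProbabilityMeasure volume[|Set.Ioc D (D + ε)] :=
    cond_isProbabilityMeasure_of_finite (by simpa using hε) (by simp)
  refine ⟨volume[|Set.Icc (D - ε) D].prod volume[|Set.Ioc D (D + ε)], inferInstance,
    prod_absolutelyContinuous_pairMeasure hΔt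
      (cond_absolutelyContinuous_restrict (by rw [omegaMinus_eq hσ, hD]; exact fun y hy => hy.2))
      (cond_absolutelyContinuous_restrict (by rw [omegaPlus_eq hσ, hD]; exact fun y hy => hy.1)),
    ?_⟩
  refine ae_twoPointMixture (A := {y | |y + shift σ r Δt| ≤ ε})
    (measurableSet_le (by fun_prop) measurable_const) ?_
  filter_upwards [Measure.quasiMeasurePreserving_fst.ae (ae_cond_mem measurableSet_Icc),
    Measure.quasiMeasurePreserving_snd.ae (ae_cond_mem measurableSet_Ioc)] with p hloss hgain
  obtain ⟨hloss_lower, hloss_upper⟩ := hloss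
  obtain ⟨hgain_lower, hgain_upper⟩ := hgain
  have hfst : |p.1 + shift σ r Δt| ≤ ε := abs_le.2 ⟨by linarith, by linarith⟩
  have hsnd : |p.2 + shift σ r Δt| ≤ ε := abs_le.2 ⟨by linarith, by linarith⟩
  exact ⟨hfst, hsnd⟩

end ProductLaws

section Integrals

variable {σ r Δt : ℝ} {μ ν : Measure ℝ}

lemma integral_pos_of_ae_pos {X : Type*} [MeasurableSpace X] {ξ : Measure X} [NeZero ξ]
    {g : X → ℝ} (hg : Integrable g ξ) (hpos : ∀ᵐ x ∂ξ, 0 < g x) : 0 < ∫ x, g x ∂ξ := by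
  have hnonneg : 0 ≤ᵐ[ξ] g := hpos.mono fun x hx => hx.le
  refine (integral_nonneg_of_ae hnonneg).lt_of_ne fun hzero => ?_
  obtain ⟨x, hx, hx_zero⟩ :=
    (hpos.and ((integral_eq_zero_iff_of_nonneg_ae hnonneg hg).1 hzero.symm)).exists
  exact hx.ne' hx_zero

lemma ae_ret_pos (hν : ν ≪ volume.restrict (omegaPlus σ r Δt)) : ∀ᵐ y ∂ν, 0 < ret σ r Δt y :=
  hν.ae_le (ae_restrict_mem measurableSet_omegaPlus)

lemma ae_ret_neg (hσ : 0 < σ) (hμ : μ ≪ volume.restrict (omegaMinus σ r Δt)) :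
    ∀ᵐ y ∂μ, ret σ r Δt y < 0 := by
  refine hμ.ae_le ?_
  filter_upwards [ae_restrict_mem measurableSet_omegaMinus,
    ae_restrict_of_ae (Measure.ae_ne volume (-shift σ r Δt))] with y hy hy_ne
  rw [omegaMinus_eq hσ] at hy
  rw [← ret_neg_shift (r := r) (Δt := Δt) hσ]
  exact strictMono_ret hσ (lt_of_le_of_ne hy hy_ne)

end Integrals

section Shift

variable {S₀ σ r Δt V δ : ℝ} {f : ℝ → ℝ} {n : ℕ} {μ ν : Measure ℝ}

/-- The payoff as a function of the increment when there is a single period. -/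
noncomputable def incrementPayoff (S₀ σ r Δt : ℝ) (f : ℝ → ℝ) (t : ℝ) : ℝ :=
  f (S₀ * (1 + ret σ r Δt t))

/-- The payoff at maturity is integrable with expectation at most `V` under every product of
one-period measures. -/
def IsExpectationBound (N : ℕ) (S₀ σ r Δt : ℝ) (f : ℝ → ℝ) (V : ℝ) : Prop :=
  ∀ Q ∈ productMeasures N σ r Δt, HasIntegralLE (fun y => f (price S₀ σ r Δt N y)) Q V

-- When the increments of all periods but the first are confined to within `δ / (n + 1)` of the
-- increment with zero return, together they only shift the increment of the first period.
lemma IsExpectationBound.exists_shift (hV : IsExpectationBound (n + 1) S₀ σ r Δt f V)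
    (hσ : 0 < σ) (hΔt : 0 < Δt) (hδ : 0 < δ) {κ : Measure (ℝ × ℝ)} [IsProbabilityMeasure κ]
    (hκ : κ ≪ pairMeasure σ r Δt) :
    ∃ τ, |τ| ≤ δ ∧ HasIntegralLE (fun t => incrementPayoff S₀ σ r Δt f (t + τ))
      (twoPointMixture σ r Δt κ) V := by
  obtain ⟨ξ, hξ_prob, hξ, hξ_near⟩ :=
    exists_concentrated_twoPointMixture (r := r) hσ hΔt (div_pos hδ n.cast_add_one_pos)
  have hprob : ∀ i, IsProbabilityMeasure
      ((Fin.cons κ fun _ => ξ : Fin (n + 1) → Measure (ℝ × ℝ)) i) :=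
    Fin.cases ‹_› fun _ => hξ_prob
  have hac : ∀ i, (Fin.cons κ fun _ => ξ : Fin (n + 1) → Measure (ℝ × ℝ)) i ≪
      pairMeasure σ r Δt := Fin.cases hκ fun _ => hξ
  have hpi := hasIntegralLE_pi_twoPointMixture hσ hΔt (fun q hq => hV _ ⟨q, hq, rfl⟩) hac
  have := fun i => isProbabilityMeasure_twoPointMixture ((hac i).ae_le ae_mem_pairMeasure)
  have := isProbabilityMeasure_twoPointMixture (hξ.ae_le ae_mem_pairMeasure)
  obtain ⟨u, hu, hle⟩ := hpi.exists_cons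
    (p := fun u => ∀ j, |u j + shift σ r Δt| ≤ δ / (n + 1)) <| ae_all_iff.2 fun j =>
      (Measure.quasiMeasurePreserving_eval (fun _ : Fin n => twoPointMixture σ r Δt ξ) j).ae hξ_near
  refine ⟨∑ j, (u j + shift σ r Δt), ?_, by
    simpa only [incrementPayoff, price_cons hσ, Fin.cons_zero] using hle⟩
  calc |∑ j, (u j + shift σ r Δt)| ≤ ∑ j, |u j + shift σ r Δt| := Finset.abs_sum_le_sum_abs _ _
    _ ≤ ∑ _j : Fin n, δ / (n + 1) := Finset.sum_le_sum fun j _ => hu j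
    _ = n / (n + 1) * δ := by simp [div_mul_eq_mul_div, mul_div_assoc]
    _ ≤ δ := mul_le_of_le_one_left hδ.le (div_le_one_of_le₀ (by linarith) (by positivity))

section Product

variable [IsProbabilityMeasure μ] [IsProbabilityMeasure ν]

lemma IsExpectationBound.exists_shift_smul_add_smul
    (hV : IsExpectationBound (n + 1) S₀ σ r Δt f V) (hσ : 0 < σ) (hΔt : 0 < Δt) (hδ : 0 < δ)
    (hμ : μ ≪ volume.restrict (omegaMinus σ r Δt)) (hν : ν ≪ volume.restrict (omegaPlus σ r Δt))
    {gain loss : ℝ≥0} (hgain : ∫⁻ y, ENNReal.ofReal (ret σ r Δt y) ∂ν = gain)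
    (hloss : ∫⁻ y, ENNReal.ofReal (-ret σ r Δt y) ∂μ = loss) (hne : gain + loss ≠ 0) :
    ∃ τ, |τ| ≤ δ ∧ HasIntegralLE (fun t => incrementPayoff S₀ σ r Δt f (t + τ))
      (gain • μ + loss • ν) (V * (gain + loss)) := by
  obtain ⟨κ, hκ⟩ : ∃ κ, ((μ.prod ν).withDensity fun p =>
    ENNReal.ofReal (max (-ret σ r Δt p.1) 0 + max (ret σ r Δt p.2) 0)) = κ := ⟨_, rfl⟩
  have hac : κ ≪ pairMeasure σ r Δt := by
    rw [← hκ]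
    exact (withDensity_absolutelyContinuous _ _).trans
      (prod_absolutelyContinuous_pairMeasure hΔt hμ hν)
  have hmix : twoPointMixture σ r Δt κ = gain • μ + loss • ν := by
    rw [← hκ, twoPointMixture_withDensity_prod, hgain, hloss]
    rfl
  have huniv : κ Set.univ = (gain + loss : ℝ≥0) := by
    rw [← twoPointMixture_univ (hac.ae_le ae_mem_pairMeasure), hmix]
    simp only [Measure.add_apply, Measure.smul_apply, measure_univ, ENNReal.smul_def, smul_eq_mul,
      mul_one, ENNReal.coe_add]
  have hprob : IsProbabilityMeasure ((gain + loss)⁻¹ • κ) := by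
    refine ⟨?_⟩
    rw [Measure.smul_apply, huniv, ENNReal.smul_def, smul_eq_mul, ← ENNReal.coe_mul,
      inv_mul_cancel₀ hne, ENNReal.coe_one]
  obtain ⟨τ, hτ, hle⟩ := hV.exists_shift hσ hΔt hδ (hac.smul_left (gain + loss)⁻¹)
  rw [twoPointMixture_smul, hmix, hasIntegralLE_smul_iff (inv_ne_zero hne), NNReal.coe_inv,
    div_inv_eq_mul, NNReal.coe_add] at hle
  exact ⟨τ, hτ, hle⟩

lemma IsExpectationBound.exists_shift_integral_le
    (hV : IsExpectationBound (n + 1) S₀ σ r Δt f V) (hσ : 0 < σ) (hΔt : 0 < Δt) (hδ : 0 < δ)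
    (hμ : μ ≪ volume.restrict (omegaMinus σ r Δt)) (hν : ν ≪ volume.restrict (omegaPlus σ r Δt))
    (hretμ : Integrable (ret σ r Δt) μ) (hretν : Integrable (ret σ r Δt) ν) :
    ∃ τ, |τ| ≤ δ ∧ Integrable (fun t => incrementPayoff S₀ σ r Δt f (t + τ)) μ ∧
      Integrable (fun t => incrementPayoff S₀ σ r Δt f (t + τ)) ν ∧
      (∫ y, ret σ r Δt y ∂ν) * (∫ t, incrementPayoff S₀ σ r Δt f (t + τ) ∂μ) -
          (∫ y, ret σ r Δt y ∂μ) * (∫ t, incrementPayoff S₀ σ r Δt f (t + τ) ∂ν) ≤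
        V * ((∫ y, ret σ r Δt y ∂ν) - ∫ y, ret σ r Δt y ∂μ) := by
  have hpos := ae_ret_pos hν
  have hneg := ae_ret_neg hσ hμ
  have hgain_pos := integral_pos_of_ae_pos hretν hpos
  have hloss_pos : 0 < -∫ y, ret σ r Δt y ∂μ := by
    rw [← integral_neg]
    exact integral_pos_of_ae_pos hretμ.neg (hneg.mono fun y hy => neg_pos.2 hy)
  have hgain := (ofReal_integral_eq_lintegral_ofReal hretν (hpos.mono fun y hy => hy.le)).symm
  have hloss : ∫⁻ y, ENNReal.ofReal (-ret σ r Δt y) ∂μ =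
      ENNReal.ofReal (-∫ y, ret σ r Δt y ∂μ) := by
    rw [← integral_neg]
    exact (ofReal_integral_eq_lintegral_ofReal hretμ.neg
      (hneg.mono fun y hy => (neg_pos.2 hy).le)).symm
  have hgain_ne := (Real.toNNReal_pos.2 hgain_pos).ne'
  have hloss_ne := (Real.toNNReal_pos.2 hloss_pos).ne'
  obtain ⟨τ, hτ, hint, hle⟩ := hV.exists_shift_smul_add_smul hσ hΔt hδ hμ hν hgain hloss
    (add_pos_of_pos_of_nonneg (Real.toNNReal_pos.2 hgain_pos) zero_le).ne'
  obtain ⟨hintμ, hintν⟩ := integrable_add_measure.1 hint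
  refine ⟨τ, hτ, (integrable_nnreal_smul_measure_iff hgain_ne).1 hintμ,
    (integrable_nnreal_smul_measure_iff hloss_ne).1 hintν, ?_⟩
  rw [integral_add_measure hintμ hintν, integral_smul_nnreal_measure,
    integral_smul_nnreal_measure] at hle
  simp only [NNReal.smul_def, smul_eq_mul, Real.coe_toNNReal _ hgain_pos.le,
    Real.coe_toNNReal _ hloss_pos.le] at hle
  linarith

end Product

end Shift

section LebesguePoints

variable {g : ℝ → ℝ} {x : ℝ}

/-- The averages of `g` over intervals shrinking to `x` converge to `g x`; the intervals have to
contain `x` but need not be centred at it. -/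
def IsLebesguePoint (g : ℝ → ℝ) (x : ℝ) : Prop :=
  ∀ w : ℝ → ℝ, (∀ᶠ s in 𝓝[>] 0, |w s - x| ≤ s) →
    Filter.Tendsto (fun s => ⨍ y in Metric.closedBall (w s) s, g y) (𝓝[>] 0) (𝓝 (g x))

lemma ae_isLebesguePoint (hg : LocallyIntegrable g) : ∀ᵐ x : ℝ, IsLebesguePoint g x := by
  filter_upwards [IsUnifLocDoublingMeasure.ae_tendsto_average volume hg 1] with x hx w hw
  refine hx w id Filter.tendsto_id (hw.mono fun s hs => ?_)
  rwa [id, one_mul, Metric.mem_closedBall, dist_comm, Real.dist_eq]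

lemma setAverage_closedBall_comp_add_right (g : ℝ → ℝ) (x s τ : ℝ) :
    ⨍ y in Metric.closedBall x s, g (y + τ) = ⨍ y in Metric.closedBall (x + τ) s, g y := by
  have hpreimage : (fun y => y + τ) ⁻¹' Metric.closedBall (x + τ) s = Metric.closedBall x s := by
    ext y
    simp [Metric.mem_closedBall]
  have hmp := measurePreserving_add_right (volume : Measure ℝ) τ
  rw [setAverage_eq, setAverage_eq, ← hpreimage,
    hmp.setIntegral_preimage_emb (measurableEmbedding_addRight τ) g,
    hmp.measureReal_preimage measurableSet_closedBall.nullMeasurableSet]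

end LebesguePoints

section Localization

variable {S₀ σ r Δt V δ : ℝ} {f : ℝ → ℝ} {n : ℕ}

lemma IsExpectationBound.exists_shift_setAverage_le
    (hV : IsExpectationBound (n + 1) S₀ σ r Δt f V) (hσ : 0 < σ) (hΔt : 0 < Δt) (hδ : 0 < δ)
    {s t : Set ℝ} (hs : s ⊆ omegaMinus σ r Δt) (ht : t ⊆ omegaPlus σ r Δt)
    (hs_bdd : Bornology.IsBounded s) (ht_bdd : Bornology.IsBounded t)
    (hs_ne : volume s ≠ 0) (ht_ne : volume t ≠ 0) :
    ∃ τ, |τ| ≤ δ ∧ IntegrableOn (fun y => incrementPayoff S₀ σ r Δt f (y + τ)) s ∧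
      IntegrableOn (fun y => incrementPayoff S₀ σ r Δt f (y + τ)) t ∧
      (⨍ y in t, ret σ r Δt y) * (⨍ y in s, incrementPayoff S₀ σ r Δt f (y + τ)) -
          (⨍ y in s, ret σ r Δt y) * (⨍ y in t, incrementPayoff S₀ σ r Δt f (y + τ)) ≤
        V * ((⨍ y in t, ret σ r Δt y) - ⨍ y in s, ret σ r Δt y) := by
  have hs_top := hs_bdd.measure_lt_top (μ := volume).ne
  have ht_top := ht_bdd.measure_lt_top (μ := volume).ne
  have hs_prob : IsProbabilityMeasure volume[|s] := cond_isProbabilityMeasure_of_finite hs_ne hs_top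
  have ht_prob : IsProbabilityMeasure volume[|t] := cond_isProbabilityMeasure_of_finite ht_ne ht_top
  have hret : ∀ u : Set ℝ, Bornology.IsBounded u → IntegrableOn (ret σ r Δt) u := fun u hu =>
    (continuous_ret.locallyIntegrable.integrableOn_isCompact hu.isCompact_closure).mono_set
      subset_closure
  have hcond : ∀ {g : ℝ → ℝ} {u : Set ℝ}, volume u ≠ 0 → volume u ≠ ⊤ →
      (Integrable g volume[|u] ↔ IntegrableOn g u) := fun h h' =>
    integrable_smul_measure (ENNReal.inv_ne_zero.2 h') (ENNReal.inv_ne_top.2 h)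
  obtain ⟨τ, hτ, hints, hintt, hle⟩ := hV.exists_shift_integral_le hσ hΔt hδ
    (cond_absolutelyContinuous_restrict hs) (cond_absolutelyContinuous_restrict ht)
    ((hcond hs_ne hs_top).2 (hret s hs_bdd)) ((hcond ht_ne ht_top).2 (hret t ht_bdd))
  refine ⟨τ, hτ, (hcond hs_ne hs_top).1 hints, (hcond ht_ne ht_top).1 hintt, ?_⟩
  simp only [setAverage_eq']
  exact hle

lemma IsExpectationBound.locallyIntegrable (hV : IsExpectationBound (n + 1) S₀ σ r Δt f V)
    (hσ : 0 < σ) (hΔt : 0 < Δt) : LocallyIntegrable (incrementPayoff S₀ σ r Δt f) := by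
  intro x
  obtain ⟨D, hD⟩ : ∃ D, -shift σ r Δt = D := ⟨_, rfl⟩
  obtain ⟨R, hR⟩ : ∃ R, |x - D| + 1 < R := exists_gt _
  have hR_pos : 0 < R := (add_pos_of_nonneg_of_pos (abs_nonneg _) one_pos).trans hR
  obtain ⟨τ, hτ, hleft, hright, -⟩ := hV.exists_shift_setAverage_le hσ hΔt one_pos
    (s := Set.Icc (D - R) D) (t := Set.Ioc D (D + R))
    (by rw [omegaMinus_eq hσ, hD]; exact fun y hy => hy.2)
    (by rw [omegaPlus_eq hσ, hD]; exact fun y hy => hy.1)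
    (Metric.isBounded_Icc _ _) (Metric.isBounded_Ioc _ _) (by simpa using hR_pos)
    (by simpa using hR_pos)
  have hunion := hleft.union hright
  rw [Set.Icc_union_Ioc_eq_Icc (by linarith) (by linarith)] at hunion
  refine ⟨Set.Icc (D - R + τ) (D + R + τ), Icc_mem_nhds ?_ ?_, ?_⟩
  · linarith [neg_abs_le (x - D), le_of_abs_le hτ]
  · linarith [le_abs_self (x - D), neg_le_of_abs_le hτ]
  · rw [← (measurePreserving_add_right volume τ).integrableOn_comp_preimage
      (measurableEmbedding_addRight τ)]
    simpa [Function.comp_def] using hunion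

lemma IsExpectationBound.exists_shift_closedBall_le
    (hV : IsExpectationBound (n + 1) S₀ σ r Δt f V) (hσ : 0 < σ) (hΔt : 0 < Δt) {a b s : ℝ}
    (hs : 0 < s) (ha : a + s ≤ -shift σ r Δt) (hb : -shift σ r Δt < b - s) :
    ∃ τ, |τ| ≤ s ∧
      (⨍ y in Metric.closedBall b s, ret σ r Δt y) *
            (⨍ y in Metric.closedBall (a + τ) s, incrementPayoff S₀ σ r Δt f y) -
          (⨍ y in Metric.closedBall a s, ret σ r Δt y) *
            (⨍ y in Metric.closedBall (b + τ) s, incrementPayoff S₀ σ r Δt f y) ≤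
        V * ((⨍ y in Metric.closedBall b s, ret σ r Δt y) -
          ⨍ y in Metric.closedBall a s, ret σ r Δt y) := by
  have hball : ∀ x : ℝ, volume (Metric.closedBall x s) ≠ 0 := fun x =>
    (Metric.measure_closedBall_pos volume x hs).ne'
  have hleft : Metric.closedBall a s ⊆ omegaMinus σ r Δt := by
    rw [omegaMinus_eq hσ, Real.closedBall_eq_Icc]
    exact fun y hy => hy.2.trans ha
  have hright : Metric.closedBall b s ⊆ omegaPlus σ r Δt := by
    rw [omegaPlus_eq hσ, Real.closedBall_eq_Icc]
    exact fun y hy => hb.trans_le hy.1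
  obtain ⟨τ, hτ, -, -, hle⟩ := hV.exists_shift_setAverage_le hσ hΔt hs hleft hright
    Metric.isBounded_closedBall Metric.isBounded_closedBall (hball a) (hball b)
  rw [setAverage_closedBall_comp_add_right, setAverage_closedBall_comp_add_right] at hle
  exact ⟨τ, hτ, hle⟩

lemma IsExpectationBound.two_point_le (hV : IsExpectationBound (n + 1) S₀ σ r Δt f V)
    (hσ : 0 < σ) (hΔt : 0 < Δt) {a b : ℝ} (ha : a < -shift σ r Δt) (hb : -shift σ r Δt < b)
    (ha_payoff : IsLebesguePoint (incrementPayoff S₀ σ r Δt f) a)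
    (hb_payoff : IsLebesguePoint (incrementPayoff S₀ σ r Δt f) b)
    (ha_ret : IsLebesguePoint (ret σ r Δt) a) (hb_ret : IsLebesguePoint (ret σ r Δt) b) :
    ret σ r Δt b * incrementPayoff S₀ σ r Δt f a - ret σ r Δt a * incrementPayoff S₀ σ r Δt f b ≤
      V * (ret σ r Δt b - ret σ r Δt a) := by
  have hsmall : ∀ᶠ s in 𝓝[>] (0 : ℝ), s ∈ Set.Ioo 0 (min (-shift σ r Δt - a) (b + shift σ r Δt)) :=
    Ioo_mem_nhdsGT (lt_min (by linarith) (by linarith))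
  have hshift := hsmall.mono fun s hs =>
    hV.exists_shift_closedBall_le hσ hΔt (a := a) (b := b) hs.1
      (by linarith [(lt_min_iff.1 hs.2).1]) (by linarith [(lt_min_iff.1 hs.2).2])
  obtain ⟨τ, hτ⟩ := hshift.choice
  have hcentred : ∀ x, ∀ᶠ s in 𝓝[>] (0 : ℝ), |x - x| ≤ s := fun x => by
    filter_upwards [hsmall] with s hs
    simpa using hs.1.le
  have hmoved : ∀ x, ∀ᶠ s in 𝓝[>] (0 : ℝ), |x + τ s - x| ≤ s := fun x =>
    hτ.mono fun s hs => by simpa using hs.1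
  have hlim_a := ha_ret (fun _ => a) (hcentred a)
  have hlim_b := hb_ret (fun _ => b) (hcentred b)
  exact le_of_tendsto_of_tendsto
    ((hlim_b.mul (ha_payoff _ (hmoved a))).sub (hlim_a.mul (hb_payoff _ (hmoved b))))
    ((hlim_b.sub hlim_a).const_mul V) (hτ.mono fun s hs => hs.2)

end Localization

section Superhedge

variable {S₀ σ r Δt V : ℝ} {f : ℝ → ℝ} {n : ℕ}

/-- The capital `V` pays for a static super-hedge of the payoff `f`: together with `m` shares
bought at the price `S₀` it dominates `f` at every positive price. -/
def IsStaticSuperhedgeCost (S₀ : ℝ) (f : ℝ → ℝ) (V : ℝ) : Prop :=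
  ∃ m, ∀ x, 0 < x → f x ≤ V + m * (x - S₀)

lemma exists_affine_majorant_of_two_point_le (hσ : 0 < σ) (hS₀ : 0 < S₀) {G : Set ℝ}
    (hG : Dense G)
    (hle : ∀ a ∈ G, ∀ b ∈ G, a ≤ -shift σ r Δt → -shift σ r Δt < b →
      ret σ r Δt b * incrementPayoff S₀ σ r Δt f a - ret σ r Δt a * incrementPayoff S₀ σ r Δt f b ≤
        V * (ret σ r Δt b - ret σ r Δt a)) :
    ∃ m, ∀ t ∈ G, incrementPayoff S₀ σ r Δt f t ≤ V + m * (S₀ * (1 + ret σ r Δt t) - S₀) := by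
  have hprice_le : ∀ t, S₀ * (1 + ret σ r Δt t) ≤ S₀ ↔ t ≤ -shift σ r Δt := fun t => by
    rw [mul_le_iff_le_one_right hS₀, add_le_iff_nonpos_right, ret_nonpos_iff hσ]
  have hlt_price : ∀ t, S₀ < S₀ * (1 + ret σ r Δt t) ↔ -shift σ r Δt < t := fun t => by
    rw [← not_le, hprice_le, not_le]
  obtain ⟨a, ha, ha_lt⟩ := hG.exists_lt (-shift σ r Δt)
  obtain ⟨b, hb, hb_gt⟩ := hG.exists_gt (-shift σ r Δt)
  have hprice_lt : S₀ * (1 + ret σ r Δt a) < S₀ := by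
    rw [mul_lt_iff_lt_one_right hS₀, add_lt_iff_neg_left, ← ret_neg_shift (r := r) (Δt := Δt) hσ]
    exact strictMono_ret hσ ha_lt
  obtain ⟨m, hm⟩ := exists_affine_majorant_of_chord_le (g := f) (c := S₀) (V := V)
    (s := (fun t => S₀ * (1 + ret σ r Δt t)) '' G)
    ⟨_, Set.mem_image_of_mem _ ha, hprice_lt⟩
    ⟨_, Set.mem_image_of_mem _ hb, (hlt_price b).2 hb_gt⟩ <| by
      rintro _ ⟨a, ha, rfl⟩ _ ⟨b, hb, rfl⟩ ha_le hb_gt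
      have hab := hle a ha b hb ((hprice_le a).1 ha_le) ((hlt_price b).1 hb_gt)
      unfold incrementPayoff at hab
      linear_combination S₀ * hab
  exact ⟨m, fun t ht => hm _ (Set.mem_image_of_mem _ ht)⟩

lemma NoNullSpikes.le_of_ae_le (hf : NoNullSpikes f) {g : ℝ → ℝ} (hg : Continuous g)
    (hle : ∀ᵐ x ∂volume.restrict (Set.Ioi 0), f x ≤ g x) {x : ℝ} (hx : 0 < x) : f x ≤ g x := by
  by_contra! hlt
  have hgap : 0 < (f x - g x) / 2 := half_pos (sub_pos.2 hlt)
  obtain ⟨δ, hδ, hclose⟩ := Metric.continuousAt_iff.1 hg.continuousAt _ hgap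
  refine (hf x hx _ hgap _ (lt_min hδ hx)).ne' (measure_mono_null ?_
    (ae_iff.1 ((ae_restrict_iff' measurableSet_Ioi).1 hle)))
  rintro z ⟨hzx, hz⟩
  have hz_pos : 0 < z := by linarith [(abs_lt.1 (hzx.trans_le (min_le_right _ _))).1]
  have hgz : g z - g x < (f x - g x) / 2 :=
    (abs_lt.1 (hclose (hzx.trans_le (min_le_left _ _)))).2
  exact fun hfg => absurd (hfg hz_pos) (by linarith)

lemma ae_exists_mul_one_add_ret_eq (hσ : 0 < σ) (hS₀ : 0 < S₀) {p : ℝ → Prop}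
    (hp : ∀ᵐ t, p t) :
    ∀ᵐ x ∂volume.restrict (Set.Ioi 0), ∃ t, p t ∧ S₀ * (1 + ret σ r Δt t) = x := by
  have hdiff : Differentiable ℝ fun t => S₀ * (1 + ret σ r Δt t) := fun t =>
    ((hasDerivAt_ret t).differentiableAt.const_add 1).const_mul S₀
  have hnull := addHaar_image_eq_zero_of_differentiableOn_of_addHaar_eq_zero volume
    hdiff.differentiableOn (ae_iff.1 hp)
  filter_upwards [ae_restrict_mem measurableSet_Ioi,
    ae_restrict_of_ae (measure_eq_zero_iff_ae_notMem.1 hnull)] with x hx hx_notMem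
  obtain ⟨t, rfl⟩ := exists_mul_one_add_ret_eq (r := r) (Δt := Δt) hσ hS₀ hx
  exact ⟨t, by_contra fun ht => hx_notMem (Set.mem_image_of_mem _ ht), rfl⟩

lemma IsExpectationBound.isStaticSuperhedgeCost (hV : IsExpectationBound (n + 1) S₀ σ r Δt f V)
    (hσ : 0 < σ) (hΔt : 0 < Δt) (hS₀ : 0 < S₀) (hf : NoNullSpikes f) :
    IsStaticSuperhedgeCost S₀ f V := by
  have hgood : ∀ᵐ t, t ≠ -shift σ r Δt ∧ IsLebesguePoint (incrementPayoff S₀ σ r Δt f) t ∧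
      IsLebesguePoint (ret σ r Δt) t := by
    filter_upwards [Measure.ae_ne volume (-shift σ r Δt),
      ae_isLebesguePoint (hV.locallyIntegrable hσ hΔt),
      ae_isLebesguePoint continuous_ret.locallyIntegrable] with t hne hpayoff hret
    exact ⟨hne, hpayoff, hret⟩
  obtain ⟨m, hm⟩ := exists_affine_majorant_of_two_point_le (r := r) (Δt := Δt) (f := f) (V := V)
    hσ hS₀ (Measure.dense_of_ae hgood) fun a ha b hb ha_le hb_gt =>
      hV.two_point_le hσ hΔt (ha_le.lt_of_ne ha.1) hb_gt ha.2.1 hb.2.1 ha.2.2 hb.2.2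
  refine ⟨m, fun x hx => hf.le_of_ae_le (g := fun x => V + m * (x - S₀)) (by fun_prop) ?_ hx⟩
  filter_upwards [ae_exists_mul_one_add_ret_eq (r := r) (Δt := Δt) hσ hS₀ hgood]
  rintro _ ⟨t, ht, rfl⟩
  exact hm t ht

end Superhedge

section Branches

variable {S₀ σ r Δt V : ℝ} {f : ℝ → ℝ} {N n : ℕ}

/-- The probabilities that centre the return of a random point of the pair `y 0`, `y 1`. -/
noncomputable def stepWeight (σ r Δt : ℝ) (y : Fin 2 → ℝ) : Fin 2 → ℝ :=
  ![weightMinus σ r Δt (y 0, y 1), weightPlus σ r Δt (y 0, y 1)]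

lemma stepWeight_nonneg (y : Fin 2 → ℝ) (i : Fin 2) : 0 ≤ stepWeight σ r Δt y i :=
  Fin.forall_fin_two (p := fun i => 0 ≤ stepWeight σ r Δt y i).2
    ⟨weightMinus_nonneg _, weightPlus_nonneg _⟩ i

lemma pair_mem_omegaMinus_prod_omegaPlus (hσ : 0 < σ) {y : Fin 2 → ℝ}
    (hy : y 0 ≤ -shift σ r Δt ∧ -shift σ r Δt < y 1) :
    (y 0, y 1) ∈ omegaMinus σ r Δt ×ˢ omegaPlus σ r Δt :=
  ⟨(ret_nonpos_iff hσ).2 hy.1, (ret_pos_iff hσ).2 hy.2⟩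

lemma branchFactor_eq_stepWeight (hσ : 0 < σ) {y : Fin 2 → ℝ}
    (hy : y 0 ≤ -shift σ r Δt ∧ -shift σ r Δt < y 1) (i : Fin 2) :
    |Real.exp (σ * (shift σ r Δt + y (i + 1))) - 1| /
        |Real.exp (σ * (shift σ r Δt + y (i + 1))) - Real.exp (σ * (shift σ r Δt + y i))| =
      stepWeight σ r Δt y i := by
  have hexp : ∀ x, Real.exp (σ * (shift σ r Δt + x)) = 1 + ret σ r Δt x := fun x => by
    rw [one_add_ret, mul_add, shift, mul_div_cancel₀ _ hσ.ne', neg_add_eq_sub]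
  have hp := pair_mem_omegaMinus_prod_omegaPlus hσ hy
  have hloss : ret σ r Δt (y 0) ≤ 0 := hp.1
  have hgain : 0 < ret σ r Δt (y 1) := hp.2
  have hdiff := ret_sub_ret_pos hp
  simp only [hexp, add_sub_cancel_left, add_sub_add_left_eq_sub]
  fin_cases i
  · exact (congrArg₂ _ (abs_of_pos hgain) (abs_of_pos hdiff)).trans (weightMinus_eq hp).symm
  · refine (congrArg₂ _ (abs_of_nonpos hloss) ?_).trans (weightPlus_eq hp).symm
    exact (abs_sub_comm _ _).trans (abs_of_pos hdiff)

lemma branchSum_eq (hσ : 0 < σ) {y : Fin N → Fin 2 → ℝ}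
    (hy : ∀ s, y s 0 ≤ -shift σ r Δt ∧ -shift σ r Δt < y s 1) :
    branchSum N S₀ σ r Δt f y = ∑ i : Fin N → Fin 2,
      f (S₀ * ∏ s, (1 + ret σ r Δt (y s (i s)))) * ∏ s, stepWeight σ r Δt (y s) (i s) := by
  simp only [branchSum, branchFactor_eq_stepWeight hσ (hy _)]

lemma sum_prod_stepWeight (hσ : 0 < σ) {y : Fin N → Fin 2 → ℝ}
    (hy : ∀ s, y s 0 ≤ -shift σ r Δt ∧ -shift σ r Δt < y s 1) :
    ∑ i : Fin N → Fin 2, ∏ s, stepWeight σ r Δt (y s) (i s) = 1 := by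
  rw [← Fintype.prod_sum]
  refine Finset.prod_eq_one fun s _ => ?_
  rw [Fin.sum_univ_two]
  exact weightMinus_add_weightPlus (pair_mem_omegaMinus_prod_omegaPlus hσ (hy s))

lemma sum_prod_one_add_ret_mul_prod_stepWeight (hσ : 0 < σ) {y : Fin N → Fin 2 → ℝ}
    (hy : ∀ s, y s 0 ≤ -shift σ r Δt ∧ -shift σ r Δt < y s 1) :
    ∑ i : Fin N → Fin 2,
      (∏ s, (1 + ret σ r Δt (y s (i s)))) * ∏ s, stepWeight σ r Δt (y s) (i s) = 1 := by
  simp only [← Finset.prod_mul_distrib]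
  rw [← Fintype.prod_sum fun s i => (1 + ret σ r Δt (y s i)) * stepWeight σ r Δt (y s) i]
  refine Finset.prod_eq_one fun s _ => ?_
  rw [Fin.sum_univ_two]
  exact one_add_ret_mul_weights (pair_mem_omegaMinus_prod_omegaPlus hσ (hy s))

lemma IsStaticSuperhedgeCost.branchSum_le (hV : IsStaticSuperhedgeCost S₀ f V) (hσ : 0 < σ)
    (hS₀ : 0 < S₀) {y : Fin N → Fin 2 → ℝ}
    (hy : ∀ s, y s 0 ≤ -shift σ r Δt ∧ -shift σ r Δt < y s 1) :
    branchSum N S₀ σ r Δt f y ≤ V := by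
  obtain ⟨m, hm⟩ := hV
  rw [branchSum_eq hσ hy]
  calc ∑ i : Fin N → Fin 2,
        f (S₀ * ∏ s, (1 + ret σ r Δt (y s (i s)))) * ∏ s, stepWeight σ r Δt (y s) (i s)
      ≤ ∑ i : Fin N → Fin 2, (V + m * (S₀ * ∏ s, (1 + ret σ r Δt (y s (i s))) - S₀)) *
          ∏ s, stepWeight σ r Δt (y s) (i s) := by
        gcongr with i
        · exact Finset.prod_nonneg fun s _ => stepWeight_nonneg _ _
        · exact hm _ (mul_pos hS₀ (Finset.prod_pos fun s _ => one_add_ret_pos _))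
    _ = (V - m * S₀) * ∑ i : Fin N → Fin 2, ∏ s, stepWeight σ r Δt (y s) (i s) +
          m * S₀ * ∑ i : Fin N → Fin 2,
            (∏ s, (1 + ret σ r Δt (y s (i s)))) * ∏ s, stepWeight σ r Δt (y s) (i s) := by
        rw [Finset.mul_sum, Finset.mul_sum, ← Finset.sum_add_distrib]
        exact Finset.sum_congr rfl fun i _ => by ring
    _ = V := by
        rw [sum_prod_stepWeight hσ hy, sum_prod_one_add_ret_mul_prod_stepWeight hσ hy]
        ring

lemma stepWeight_of_ret_eq_zero (hσ : 0 < σ) {y : Fin 2 → ℝ} (hy : -shift σ r Δt < y 1)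
    (hy_zero : ret σ r Δt (y 0) = 0) : stepWeight σ r Δt y = Pi.single 0 1 := by
  have hgain : 0 < ret σ r Δt (y 1) := (ret_pos_iff hσ).2 hy
  have hp : (y 0, y 1) ∈ omegaMinus σ r Δt ×ˢ omegaPlus σ r Δt := ⟨hy_zero.le, hgain⟩
  refine funext (Fin.forall_fin_two.2 ⟨(weightMinus_eq hp).trans ?_, (weightPlus_eq hp).trans ?_⟩)
  · simp [hy_zero, hgain.ne']
  · simp [hy_zero]

-- If the return at the lower point is zero, that point carries all the weight. With such pairs in
-- all periods but the first, the sum over the branches reduces to the first period.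
lemma two_point_mem_branchValues (hσ : 0 < σ) {y : Fin 2 → ℝ}
    (hy : y 0 ≤ -shift σ r Δt ∧ -shift σ r Δt < y 1) :
    ∑ i, incrementPayoff S₀ σ r Δt f (y i) * stepWeight σ r Δt y i ∈
      branchValues (n + 1) S₀ σ r Δt f := by
  obtain ⟨z, hz_zero, hz_one⟩ : ∃ z : Fin 2 → ℝ, z 0 = -shift σ r Δt ∧ -shift σ r Δt < z 1 :=
    ⟨![-shift σ r Δt, -shift σ r Δt + 1], rfl, lt_add_one _⟩
  have hret : ret σ r Δt (z 0) = 0 := by rw [hz_zero, ret_neg_shift hσ]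
  have hweight : stepWeight σ r Δt z = Pi.single 0 1 := stepWeight_of_ret_eq_zero hσ hz_one hret
  have hpoints : ∀ s, (Fin.cons y fun _ => z : Fin (n + 1) → Fin 2 → ℝ) s 0 ≤ -shift σ r Δt ∧
      -shift σ r Δt < (Fin.cons y fun _ => z : Fin (n + 1) → Fin 2 → ℝ) s 1 :=
    Fin.cases hy fun _ => ⟨hz_zero.le, hz_one⟩
  refine ⟨Fin.cons y fun _ => z, hpoints, ?_⟩
  rw [branchSum_eq hσ hpoints, ← (Fin.consEquiv fun _ => Fin 2).sum_comp, Fintype.sum_prod_type]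
  refine Finset.sum_congr rfl fun i _ => ?_
  rw [Finset.sum_eq_single 0]
  · simp [Fin.prod_univ_succ, Fin.consEquiv, hret, hweight, incrementPayoff]
  · intro j _ hj
    obtain ⟨s, hs⟩ := Function.ne_iff.1 hj
    have hzero : ∏ s, stepWeight σ r Δt z (j s) = 0 :=
      Finset.prod_eq_zero (Finset.mem_univ s) (by rw [hweight]; exact Pi.single_eq_of_ne hs 1)
    simp [Fin.prod_univ_succ, Fin.consEquiv, hzero]
  · exact fun hmem => absurd (Finset.mem_univ _) hmem

lemma isStaticSuperhedgeCost_of_mem_upperBounds_branchValues (hσ : 0 < σ) (hS₀ : 0 < S₀)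
    (hV : V ∈ upperBounds (branchValues (n + 1) S₀ σ r Δt f)) :
    IsStaticSuperhedgeCost S₀ f V := by
  obtain ⟨m, hm⟩ := exists_affine_majorant_of_two_point_le (r := r) (Δt := Δt) (f := f) (V := V)
    hσ hS₀ dense_univ fun a _ b _ ha hb => by
      have hy : ![a, b] 0 ≤ -shift σ r Δt ∧ -shift σ r Δt < ![a, b] 1 := ⟨ha, hb⟩
      have hp : (a, b) ∈ omegaMinus σ r Δt ×ˢ omegaPlus σ r Δt :=
        pair_mem_omegaMinus_prod_omegaPlus hσ hy
      have hle := hV (two_point_mem_branchValues hσ hy)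
      simp only [Fin.sum_univ_two, stepWeight, Matrix.cons_val_zero, Matrix.cons_val_one,
        weightMinus_eq hp, weightPlus_eq hp] at hle
      rw [mul_div_assoc', mul_div_assoc', ← add_div, div_le_iff₀ (ret_sub_ret_pos hp)] at hle
      linarith
  refine ⟨m, fun x hx => ?_⟩
  obtain ⟨t, rfl⟩ := exists_mul_one_add_ret_eq (r := r) (Δt := Δt) hσ hS₀ hx
  exact hm t (Set.mem_univ t)

lemma mem_upperBounds_branchValues_iff (hσ : 0 < σ) (hS₀ : 0 < S₀) :
    V ∈ upperBounds (branchValues (n + 1) S₀ σ r Δt f) ↔ IsStaticSuperhedgeCost S₀ f V := by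
  refine ⟨isStaticSuperhedgeCost_of_mem_upperBounds_branchValues hσ hS₀, fun hV => ?_⟩
  rintro _ ⟨y, hy, rfl⟩
  exact hV.branchSum_le hσ hS₀ hy

lemma branchValues_zero : branchValues 0 S₀ σ r Δt f = {f S₀} := by
  refine Set.ext fun x => ⟨?_, fun hx => ⟨Fin.elim0, fun i => i.elim0, ?_⟩⟩
  · rintro ⟨y, -, rfl⟩
    simp [branchSum]
  · simpa [branchSum] using hx

lemma nonempty_branchValues : (branchValues N S₀ σ r Δt f).Nonempty :=
  ⟨_, fun _ => ![-shift σ r Δt, -shift σ r Δt + 1], fun _ => by simp, rfl⟩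

end Branches

section Expectations

variable {S₀ σ r Δt V : ℝ} {f : ℝ → ℝ} {N : ℕ}

lemma isProbabilityMeasure_of_mem_onePeriodMeasures {Q : Measure ℝ}
    (hQ : Q ∈ onePeriodMeasures σ r Δt) : IsProbabilityMeasure Q := by
  obtain ⟨κ, hprob, hκ, -, rfl⟩ := mem_onePeriodMeasures_iff.1 hQ
  exact isProbabilityMeasure_twoPointMixture (hκ.ae_le ae_mem_pairMeasure)

lemma hasIntegral_one_add_ret_of_mem_onePeriodMeasures {Q : Measure ℝ}
    (hQ : Q ∈ onePeriodMeasures σ r Δt) :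
    Integrable (fun y => 1 + ret σ r Δt y) Q ∧ ∫ y, (1 + ret σ r Δt y) ∂Q = 1 := by
  obtain ⟨κ, hprob, hκ, -, rfl⟩ := mem_onePeriodMeasures_iff.1 hQ
  exact hasIntegral_one_add_ret_twoPointMixture (hκ.ae_le ae_mem_pairMeasure)

lemma isProbabilityMeasure_of_mem_productMeasures {Q : Measure (Fin N → ℝ)}
    (hQ : Q ∈ productMeasures N σ r Δt) : IsProbabilityMeasure Q := by
  obtain ⟨q, hq, rfl⟩ := hQ
  have := fun i => isProbabilityMeasure_of_mem_onePeriodMeasures (hq i)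
  infer_instance

lemma hasIntegral_price_of_mem_productMeasures {Q : Measure (Fin N → ℝ)}
    (hQ : Q ∈ productMeasures N σ r Δt) :
    Integrable (price S₀ σ r Δt N) Q ∧ ∫ y, price S₀ σ r Δt N y ∂Q = S₀ := by
  obtain ⟨q, hq, rfl⟩ := hQ
  have := fun i => isProbabilityMeasure_of_mem_onePeriodMeasures (hq i)
  have hret := fun i => hasIntegral_one_add_ret_of_mem_onePeriodMeasures (hq i)
  simp only [funext (f := price S₀ σ r Δt N) price_eq_prod]
  refine ⟨(Integrable.fintype_prod fun i => (hret i).1).const_mul S₀, ?_⟩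
  rw [integral_const_mul, integral_fintype_prod_eq_prod fun _ t => 1 + ret σ r Δt t,
    Finset.prod_eq_one fun i _ => (hret i).2, mul_one]

lemma IsStaticSuperhedgeCost.isExpectationBound (hV : IsStaticSuperhedgeCost S₀ f V)
    (hS₀ : 0 < S₀)
    (hint : ∀ Q ∈ productMeasures N σ r Δt, Integrable (fun y => f (price S₀ σ r Δt N y)) Q) :
    IsExpectationBound N S₀ σ r Δt f V := by
  obtain ⟨m, hm⟩ := hV
  intro Q hQ
  have := isProbabilityMeasure_of_mem_productMeasures hQ
  obtain ⟨hprice, hprice_mean⟩ := hasIntegral_price_of_mem_productMeasures (S₀ := S₀) hQ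
  have hgain : Integrable (fun y => m * (price S₀ σ r Δt N y - S₀)) Q :=
    (hprice.sub (integrable_const S₀)).const_mul m
  refine ⟨hint Q hQ, ?_⟩
  calc ∫ y, f (price S₀ σ r Δt N y) ∂Q ≤ ∫ y, (V + m * (price S₀ σ r Δt N y - S₀)) ∂Q :=
        integral_mono (hint Q hQ) ((integrable_const V).add hgain) fun y =>
          hm _ (mul_pos hS₀ (Real.exp_pos _))
    _ = V := by
        rw [integral_add (integrable_const V) hgain, integral_const_mul,
          integral_sub hprice (integrable_const S₀), hprice_mean]
        simp

lemma mem_upperBounds_expectations_iff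
    (hint : ∀ Q ∈ martingaleMeasures N σ r Δt, Integrable (fun y => f (price S₀ σ r Δt N y)) Q) :
    V ∈ upperBounds (expectations N S₀ σ r Δt f) ↔ IsExpectationBound N S₀ σ r Δt f V := by
  constructor
  · intro hV Q hQ
    have hQ' := subset_convexHull ℝ≥0 _ hQ
    exact ⟨hint Q hQ', hV ⟨Q, hQ', rfl⟩⟩
  · rintro hV _ ⟨Q, hQ, rfl⟩
    exact (convexHull_min hV convex_setOf_hasIntegralLE hQ).2

lemma nonempty_productMeasures (hσ : 0 < σ) (hΔt : 0 < Δt) :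
    (productMeasures N σ r Δt).Nonempty := by
  obtain ⟨Q, hQ⟩ := nonempty_onePeriodMeasures (r := r) hσ hΔt
  exact ⟨_, fun _ => Q, fun _ => hQ, rfl⟩

lemma nonempty_expectations (hσ : 0 < σ) (hΔt : 0 < Δt) :
    (expectations N S₀ σ r Δt f).Nonempty := by
  obtain ⟨Q, hQ⟩ := nonempty_productMeasures (N := N) (r := r) hσ hΔt
  exact ⟨_, Q, subset_convexHull ℝ≥0 _ hQ, rfl⟩

lemma isExpectationBound_zero_iff (hσ : 0 < σ) (hΔt : 0 < Δt) :
    IsExpectationBound 0 S₀ σ r Δt f V ↔ f S₀ ≤ V := by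
  have hprice : ∀ y : Fin 0 → ℝ, price S₀ σ r Δt 0 y = S₀ := fun y => by simp [price, walk]
  simp only [IsExpectationBound, HasIntegralLE, hprice]
  constructor
  · intro hV
    obtain ⟨Q, hQ⟩ := nonempty_productMeasures (N := 0) (r := r) hσ hΔt
    have := isProbabilityMeasure_of_mem_productMeasures hQ
    simpa using (hV Q hQ).2
  · intro hV Q hQ
    have := isProbabilityMeasure_of_mem_productMeasures hQ
    simpa using hV

lemma upperBounds_expectations_eq (hS₀ : 0 < S₀) (hΔt : 0 < Δt) (hσ : 0 < σ)
    (hf : NoNullSpikes f)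
    (hint : ∀ Q ∈ martingaleMeasures N σ r Δt, Integrable (fun y => f (price S₀ σ r Δt N y)) Q) :
    upperBounds (expectations N S₀ σ r Δt f) = upperBounds (branchValues N S₀ σ r Δt f) := by
  ext V
  rw [mem_upperBounds_expectations_iff hint]
  cases N with
  | zero => rw [isExpectationBound_zero_iff hσ hΔt, branchValues_zero, upperBounds_singleton,
      Set.mem_Ici]
  | succ n =>
    rw [mem_upperBounds_branchValues_iff hσ hS₀]
    exact ⟨fun hV => hV.isStaticSuperhedgeCost hσ hΔt hS₀ hf, fun hV =>
      hV.isExpectationBound hS₀ fun Q hQ => hint Q (subset_convexHull ℝ≥0 _ hQ)⟩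

end Expectations

end DiscreteGBM

theorem mainTheorem5_general (N : ℕ) (S₀ σ r Δt : ℝ) (hS₀ : 0 < S₀) (hΔt : 0 < Δt) (hσ : 0 < σ)
    (f : ℝ → ℝ) (hspike : DiscreteGBM.NoNullSpikes f)
    (hint : ∀ Q ∈ DiscreteGBM.martingaleMeasures N σ r Δt,
      Integrable (fun y => f (DiscreteGBM.price S₀ σ r Δt N y)) Q)
    (hsup : BddAbove (DiscreteGBM.expectations N S₀ σ r Δt f)) :
    BddAbove (DiscreteGBM.branchValues N S₀ σ r Δt f) ∧
      sSup (DiscreteGBM.expectations N S₀ σ r Δt f) =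
        sSup (DiscreteGBM.branchValues N S₀ σ r Δt f) := by
  have hbounds := DiscreteGBM.upperBounds_expectations_eq hS₀ hΔt hσ hspike hint
  have hlub := isLUB_csSup (DiscreteGBM.nonempty_expectations hσ hΔt) hsup
  rw [IsLUB, hbounds] at hlub
  exact ⟨⟨_, hlub.1⟩, (IsLUB.csSup_eq hlub DiscreteGBM.nonempty_branchValues).symm⟩

theorem mainTheorem5 (N : ℕ) (S₀ σ r Δt : ℝ) (hS₀ : 0 < S₀) (hΔt : 0 < Δt) (hσ : 0 < σ)
    (hσ' : σ < 1 / (2 * Δt)) (f : ℝ → ℝ) (hf : Measurable f)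
    (hspike : DiscreteGBM.NoNullSpikes f)
    (hint : ∀ Q ∈ DiscreteGBM.martingaleMeasures N σ r Δt,
      Integrable (fun y => f (DiscreteGBM.price S₀ σ r Δt N y)) Q)
    (hsup : BddAbove (DiscreteGBM.expectations N S₀ σ r Δt f)) :
    BddAbove (DiscreteGBM.branchValues N S₀ σ r Δt f) ∧
      sSup (DiscreteGBM.expectations N S₀ σ r Δt f) =
        sSup (DiscreteGBM.branchValues N S₀ σ r Δt f) :=
  mainTheorem5_general N S₀ σ r Δt hS₀ hΔt hσ f hspike hint hsup
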